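/- Let $d>0$, let $\alpha,\beta,\gamma,\delta\in\mathbb R$ satisfy $\alpha\beta-\gamma\delta=-1$, and put $\Lambda=\begin{pmatrix}\gamma&\beta\\ \alpha&\delta\end{pmatrix}$, $x_n=nd+d/2$ for $n\in\mathbb Z$, and $F=(f,f')^{T}$. Let $h_\Lambda$ be the generalized Kronig--Penney operator in $L^2(\mathbb R)$, that is, $h_\Lambda f=-f''$ with domain $$D(h_\Lambda)=\Big\{f\in H^{2,2}\big(\mathbb R\setminus\textstyle\bigcup_n\{x_n\}\big):\ F(x_n+)=\Lambda F(x_n-)\ \text{for all } n\in\mathbb Z\Big\}.$$ Then the real spectrum $\sigma(h_\Lambda)$ is non-empty and bounded from below. Let $E_0=\inf\sigma(h_\Lambda)$. Call a function $u:\mathbb R\setminus\bigcup_n\{x_n\}\to\mathbb C$, $u\not\equiv0$, a $\theta$-periodic solution at $E_0$ (with $\theta\in\mathbb R$) if $-u''=E_0u$ off the points $x_n$, $U(x_n+)=\Lambda U(x_n-)$ for all $n$, where $U=(u,u')^{T}$, and $u(x+d)=e^{i\theta}u(x)$ for all $x\ne x_n$. Such a solution exists for some real $\theta$, and every such solution $u$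 (for any real $\theta$) is - periodic, $u(x+d)=u(x)$ for all $x\neq x_n$, if $\beta>0$, or if $\beta=0$ and $\gamma>0$; - antiperiodic, $u(x+d)=-u(x)$ for all $x\neq x_n$, if $\beta<0$, or if $\beta=0$ and $\gamma<0$. -/

import Mathlib

open MeasureTheory Filter Topology

namespace KronigPenney

/-- The Hilbert space `L²(ℝ)` of complex-valued functions. -/
abbrev L2 : Type := Lp ℂ 2 (volume : Measure ℝ)

/-! ### Spectrum of an unbounded operator -/

/-- `z` is a regular point (an element of the resolvent set) of the operator `T`: the map
`T - z` is a bijection from the domain of `T` onto the space and its inverse is bounded. -/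
def IsRegularPoint {H : Type*} [NormedAddCommGroup H] [NormedSpace ℂ H]
    (T : H →ₗ.[ℂ] H) (z : ℂ) : Prop :=
  ∃ R : H →L[ℂ] H,
    (∀ f : H, ∃ hf : R f ∈ T.domain, T ⟨R f, hf⟩ - z • R f = f) ∧
    ∀ u : T.domain, R (T u - z • (u : H)) = u

/-- The spectrum of an unbounded operator: the complement of its resolvent set. -/
def unboundedSpectrum {H : Type*} [NormedAddCommGroup H] [NormedSpace ℂ H]
    (T : H →ₗ.[ℂ] H) : Set ℂ :=
  {z | ¬ IsRegularPoint T z}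

/-! ### Interaction sites and the matching condition -/

/-- The interaction site `x_n = n d + d / 2`. -/
noncomputable def site (d : ℝ) (n : ℤ) : ℝ := n * d + d / 2

/-- The real line without the interaction sites. -/
def freeRegion (d : ℝ) : Set ℝ := (Set.range (site d))ᶜ

/-- The transfer matrix `Λ = (γ β; α δ)` (with trivial phase), as a complex matrix. -/
noncomputable def transferMatrix (α β γ δ : ℝ) : Matrix (Fin 2) (Fin 2) ℂ :=
  !![(γ : ℂ), (β : ℂ); (α : ℂ), (δ : ℂ)]

/-- The vector `(u, u')`. -/
noncomputable def jet (u : ℝ → ℂ) (x : ℝ) : Fin 2 → ℂ := ![u x, deriv u x]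

/-- The one-sided limits `U(x-)`, `U(x+)` of `U = (u, u')` exist and `U(x+) = Λ U(x-)`. -/
def MatchesAt (Λ : Matrix (Fin 2) (Fin 2) ℂ) (u : ℝ → ℂ) (x : ℝ) : Prop :=
  ∃ Um Up : Fin 2 → ℂ, Tendsto (jet u) (𝓝[<] x) (𝓝 Um) ∧ Tendsto (jet u) (𝓝[>] x) (𝓝 Up) ∧
    Up = Λ.mulVec Um

/-! ### The Sobolev space `H^{2,2}` off the interaction sites -/

/-- `u` is the continuously differentiable representative of an element of `H^{2,2}(Ω)` (`Ω` an
open subset of the line), and `w` is its second derivative: `u` is differentiable on `Ω`, `u'` is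
locally absolutely continuous on `Ω` with a.e. derivative `w`, and `u`, `u'`, `w` belong to
`L²(Ω)`. -/
structure IsH2With (Ω : Set ℝ) (u w : ℝ → ℂ) : Prop where
  differentiableAt : ∀ x ∈ Ω, DifferentiableAt ℝ u x
  deriv_ac : ∀ a b : ℝ, Set.uIcc a b ⊆ Ω → AbsolutelyContinuousOnInterval (deriv u) a b
  hasDerivAt_deriv : ∀ᵐ x ∂(volume.restrict Ω), HasDerivAt (deriv u) (w x) x
  memLp : MemLp u 2 (volume.restrict Ω)
  memLp_deriv : MemLp (deriv u) 2 (volume.restrict Ω)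
  memLp_deriv2 : MemLp w 2 (volume.restrict Ω)

/-- The pair `(f, g)` belongs to the graph of `h_Λ`: `f` is (the class of) a function `u` in
`H^{2,2}` off the sites that satisfies the matching condition at every site, and `g = -u''`. -/
def InGraph (d : ℝ) (Λ : Matrix (Fin 2) (Fin 2) ℂ) (f g : L2) : Prop :=
  ∃ u : ℝ → ℂ, f =ᵐ[volume] u ∧ IsH2With (freeRegion d) u (fun x => -(g x)) ∧
    ∀ n : ℤ, MatchesAt Λ u (site d n)

theorem isOpen_freeRegion (d : ℝ) : IsOpen (freeRegion d) := by
  rw [freeRegion, isOpen_compl_iff]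
  rcases eq_or_ne d 0 with rfl | hd
  · have : Set.range (site 0) = {0} := by ext x; simp [site, eq_comm]
    rw [this]; exact isClosed_singleton
  · have h := ((Homeomorph.mulRight₀ d hd).trans
      (Homeomorph.addRight (d / 2))).isClosedEmbedding.comp Int.isClosedEmbedding_coe_real
    exact h.isClosed_range

theorem ae_mem_freeRegion (d : ℝ) : ∀ᵐ x : ℝ, x ∈ freeRegion d := by
  have : (Set.range (site d)).Countable := Set.countable_range _
  exact this.ae_notMem volume

theorem restrict_freeRegion (d : ℝ) :
    (volume : Measure ℝ).restrict (freeRegion d) = volume :=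
  Measure.restrict_eq_self_of_ae_mem (ae_mem_freeRegion d)

theorem nhdsLT_mem_freeRegion {d : ℝ} (hd : 0 < d) (n : ℤ) :
    ∀ᶠ x in 𝓝[<] (site d n), x ∈ freeRegion d := by
  have : Set.Ioo (site d n - d) (site d n) ∈ 𝓝[<] (site d n) :=
    Ioo_mem_nhdsLT (by linarith)
  filter_upwards [this] with x hx
  rintro ⟨m, rfl⟩
  simp only [site, Set.mem_Ioo] at hx
  have h1 : ((n - 1 : ℤ) : ℝ) < m := by push_cast; nlinarith [hx.1]
  have h2 : (m : ℝ) < n := by nlinarith [hx.2]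
  have h1' : n - 1 < m := by exact_mod_cast h1
  have h2' : m < n := by exact_mod_cast h2
  omega

theorem nhdsGT_mem_freeRegion {d : ℝ} (hd : 0 < d) (n : ℤ) :
    ∀ᶠ x in 𝓝[>] (site d n), x ∈ freeRegion d := by
  have : Set.Ioo (site d n) (site d n + d) ∈ 𝓝[>] (site d n) :=
    Ioo_mem_nhdsGT (by linarith)
  filter_upwards [this] with x hx
  rintro ⟨m, rfl⟩
  simp only [site, Set.mem_Ioo] at hx
  have h1 : (m : ℝ) < ((n + 1 : ℤ) : ℝ) := by push_cast; nlinarith [hx.2]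
  have h2 : (n : ℝ) < m := by nlinarith [hx.1]
  have h1' : m < n + 1 := by exact_mod_cast h1
  have h2' : n < m := by exact_mod_cast h2
  omega

theorem jet_add {u v : ℝ → ℂ} {x : ℝ} (hu : DifferentiableAt ℝ u x)
    (hv : DifferentiableAt ℝ v x) : jet (u + v) x = jet u x + jet v x := by
  ext i; fin_cases i <;> simp [jet, deriv_add hu hv]

theorem deriv_smul_fun (c : ℂ) (u : ℝ → ℂ) : deriv (c • u) = c • deriv u := by
  ext x; simp [Pi.smul_def]

theorem jet_smul (c : ℂ) (u : ℝ → ℂ) : jet (c • u) = c • jet u := by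
  ext x i; fin_cases i <;> simp [jet, deriv_smul_fun]

theorem InGraph.zero (d : ℝ) (Λ : Matrix (Fin 2) (Fin 2) ℂ) : InGraph d Λ 0 0 := by
  have hd0 : deriv (0 : ℝ → ℂ) = 0 := by ext x; simp
  have hw : (fun x => -((0 : L2) x)) =ᵐ[volume] (0 : ℝ → ℂ) := by
    filter_upwards [Lp.coeFn_zero ℂ 2 (volume : Measure ℝ)] with x hx
    rw [hx]; simp
  refine ⟨0, Lp.coeFn_zero ℂ 2 volume, ⟨?_, ?_, ?_, ?_, ?_, ?_⟩, ?_⟩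
  · intro x _; exact differentiableAt_const (0 : ℂ)
  · intro a b _
    rw [hd0]
    simp [AbsolutelyContinuousOnInterval, tendsto_const_nhds]
  · rw [restrict_freeRegion, hd0]
    filter_upwards [hw] with x hx
    rw [hx]
    exact hasDerivAt_const x (0 : ℂ)
  · exact MemLp.zero
  · rw [hd0]; exact MemLp.zero
  · rw [restrict_freeRegion]; exact (memLp_congr_ae hw).2 MemLp.zero
  · intro n
    have : jet 0 = fun _ => 0 := by
      ext x i; fin_cases i <;> simp [jet]
    exact ⟨0, 0, by rw [this]; exact tendsto_const_nhds, by rw [this]; exact tendsto_const_nhds,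
      by simp⟩

theorem InGraph.add {d : ℝ} (hd : 0 < d) {Λ : Matrix (Fin 2) (Fin 2) ℂ} {f₁ g₁ f₂ g₂ : L2}
    (h₁ : InGraph d Λ f₁ g₁) (h₂ : InGraph d Λ f₂ g₂) :
    InGraph d Λ (f₁ + f₂) (g₁ + g₂) := by
  obtain ⟨u, hfu, hu, mu⟩ := h₁
  obtain ⟨v, hfv, hv, mv⟩ := h₂
  have hder : ∀ x ∈ freeRegion d, deriv (u + v) x = (deriv u + deriv v) x := fun x hx =>
    deriv_add (hu.differentiableAt x hx) (hv.differentiableAt x hx)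
  have hderae : deriv (u + v) =ᵐ[volume] deriv u + deriv v := by
    filter_upwards [ae_mem_freeRegion d] with x hx using hder x hx
  have hw : (fun x => -((g₁ + g₂ : L2) x)) =ᵐ[volume] (fun x => -(g₁ x)) + fun x => -(g₂ x) := by
    filter_upwards [Lp.coeFn_add g₁ g₂] with x hx
    simp only [hx, Pi.add_apply]; ring
  refine ⟨u + v, ?_, ⟨?_, ?_, ?_, ?_, ?_, ?_⟩, ?_⟩
  · exact (Lp.coeFn_add f₁ f₂).trans (hfu.add hfv)
  · exact fun x hx => (hu.differentiableAt x hx).add (hv.differentiableAt x hx)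
  · intro a b hab
    have h := (hu.deriv_ac a b hab).add (hv.deriv_ac a b hab)
    refine (tendsto_congr' ?_).2 h
    filter_upwards [mem_inf_of_right (mem_principal_self _)] with E hE
    refine Finset.sum_congr rfl fun i hi => ?_
    rw [hder _ (hab (hE.1 i hi).1), hder _ (hab (hE.1 i hi).2)]
  · have e1 := hu.hasDerivAt_deriv
    have e2 := hv.hasDerivAt_deriv
    rw [restrict_freeRegion] at *
    filter_upwards [e1, e2, hw, ae_mem_freeRegion d] with x h1 h2 h3 hx
    rw [h3]
    refine (h1.add h2).congr_of_eventuallyEq ?_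
    filter_upwards [(isOpen_freeRegion d).mem_nhds hx] with y hy using hder y hy
  · exact hu.memLp.add hv.memLp
  · have e := hu.memLp_deriv.add hv.memLp_deriv
    rw [restrict_freeRegion] at *
    exact (memLp_congr_ae hderae).2 e
  · have e := hu.memLp_deriv2.add hv.memLp_deriv2
    rw [restrict_freeRegion] at *
    exact (memLp_congr_ae hw).2 e
  · intro n
    obtain ⟨Um, Up, a1, a2, a3⟩ := mu n
    obtain ⟨Vm, Vp, b1, b2, b3⟩ := mv n
    refine ⟨Um + Vm, Up + Vp, (tendsto_congr' ?_).2 (a1.add b1),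
      (tendsto_congr' ?_).2 (a2.add b2), by rw [a3, b3, Matrix.mulVec_add]⟩
    · filter_upwards [nhdsLT_mem_freeRegion hd n] with x hx
      exact jet_add (hu.differentiableAt x hx) (hv.differentiableAt x hx)
    · filter_upwards [nhdsGT_mem_freeRegion hd n] with x hx
      exact jet_add (hu.differentiableAt x hx) (hv.differentiableAt x hx)

theorem InGraph.smul {d : ℝ} {Λ : Matrix (Fin 2) (Fin 2) ℂ} {f g : L2} (c : ℂ)
    (h : InGraph d Λ f g) : InGraph d Λ (c • f) (c • g) := by
  obtain ⟨u, hfu, hu, mu⟩ := h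
  have hw : (fun x => -((c • g : L2) x)) =ᵐ[volume] c • fun x => -(g x) := by
    filter_upwards [Lp.coeFn_smul c g] with x hx
    simp [hx]
  refine ⟨c • u, ?_, ⟨?_, ?_, ?_, ?_, ?_, ?_⟩, ?_⟩
  · filter_upwards [Lp.coeFn_smul c f, hfu] with x h1 h2
    simp [h1, h2]
  · exact fun x hx => (hu.differentiableAt x hx).const_smul c
  · intro a b hab
    rw [deriv_smul_fun]
    exact (hu.deriv_ac a b hab).const_smul c
  · have e1 := hu.hasDerivAt_deriv
    rw [restrict_freeRegion] at *
    filter_upwards [e1, hw] with x h1 h3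
    rw [h3, deriv_smul_fun]
    exact h1.const_smul c
  · exact hu.memLp.const_smul c
  · rw [deriv_smul_fun]; exact hu.memLp_deriv.const_smul c
  · have e := hu.memLp_deriv2.const_smul c
    rw [restrict_freeRegion] at *
    exact (memLp_congr_ae hw).2 e
  · intro n
    obtain ⟨Um, Up, a1, a2, a3⟩ := mu n
    refine ⟨c • Um, c • Up, ?_, ?_, by rw [a3, Matrix.mulVec_smul]⟩
    · rw [jet_smul]; exact a1.const_smul c
    · rw [jet_smul]; exact a2.const_smul c

theorem InGraph.unique {d : ℝ} {Λ : Matrix (Fin 2) (Fin 2) ℂ} {f g₁ g₂ : L2}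
    (h₁ : InGraph d Λ f g₁) (h₂ : InGraph d Λ f g₂) : g₁ = g₂ := by
  obtain ⟨u, hfu, hu, -⟩ := h₁
  obtain ⟨v, hfv, hv, -⟩ := h₂
  have hO := isOpen_freeRegion d
  have huv : Set.EqOn u v (freeRegion d) := by
    refine Measure.eqOn_open_of_ae_eq (μ := volume) ?_ hO
      (fun x hx => (hu.differentiableAt x hx).continuousAt.continuousWithinAt)
      (fun x hx => (hv.differentiableAt x hx).continuousAt.continuousWithinAt)
    exact ae_restrict_of_ae (hfu.symm.trans hfv)
  have hder : Set.EqOn (deriv u) (deriv v) (freeRegion d) := fun x hx =>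
    (huv.eventuallyEq_of_mem (hO.mem_nhds hx)).deriv_eq
  have e1 := hu.hasDerivAt_deriv
  have e2 := hv.hasDerivAt_deriv
  rw [restrict_freeRegion] at e1 e2
  apply Lp.ext
  filter_upwards [e1, e2, ae_mem_freeRegion d] with x h1 h2 hx
  have h3 := h2.congr_of_eventuallyEq (hder.eventuallyEq_of_mem (hO.mem_nhds hx))
  exact neg_injective (h1.unique h3)

/-- The graph of `h_Λ` as a subspace of `L²(ℝ) × L²(ℝ)`. -/
def graph (d : ℝ) (hd : 0 < d) (Λ : Matrix (Fin 2) (Fin 2) ℂ) : Submodule ℂ (L2 × L2) where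
  carrier := {p | InGraph d Λ p.1 p.2}
  add_mem' h₁ h₂ := InGraph.add hd h₁ h₂
  zero_mem' := InGraph.zero d Λ
  smul_mem' c _ h := InGraph.smul c h

/-- The generalized Kronig–Penney operator `h_Λ f = -f''` in `L²(ℝ)`, whose domain consists of the
functions in `H^{2,2}` off the sites with `F(x_n+) = Λ F(x_n-)` at every site. -/
noncomputable def kronigPenney (d : ℝ) (hd : 0 < d) (Λ : Matrix (Fin 2) (Fin 2) ℂ) :
    L2 →ₗ.[ℂ] L2 :=
  (graph d hd Λ).toLinearPMap

/-- The graph of the operator is the expected one. -/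
theorem mem_graph_kronigPenney {d : ℝ} (hd : 0 < d) (Λ : Matrix (Fin 2) (Fin 2) ℂ) (f g : L2) :
    (f, g) ∈ (kronigPenney d hd Λ).graph ↔ InGraph d Λ f g := by
  have h : (graph d hd Λ).toLinearPMap.graph = graph d hd Λ := by
    apply Submodule.toLinearPMap_graph_eq
    rintro ⟨f, g⟩ hx hf
    obtain rfl : f = 0 := hf
    exact InGraph.unique (g₁ := g) (g₂ := 0) hx (InGraph.zero d Λ)
  rw [kronigPenney, h]
  rfl

/-- The real points of the spectrum of `h_Λ`. As `h_Λ` is self-adjoint, this is the whole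
spectrum, regarded as a subset of `ℝ`. -/
def realSpectrum (d : ℝ) (hd : 0 < d) (Λ : Matrix (Fin 2) (Fin 2) ℂ) : Set ℝ :=
  {E | (E : ℂ) ∈ unboundedSpectrum (kronigPenney d hd Λ)}

/-- `u` (whose values at the sites are irrelevant) is a nonzero `θ`-periodic solution of
`-u'' = E u` off the sites, with `U(x_n+) = Λ U(x_n-)` at every site:
`u (x + d) = e^{iθ} u x`. -/
structure IsBlochSolution (d : ℝ) (Λ : Matrix (Fin 2) (Fin 2) ℂ) (E θ : ℝ) (u : ℝ → ℂ) :
    Prop where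
  differentiableAt : ∀ x ∈ freeRegion d, DifferentiableAt ℝ u x
  equation : ∀ x ∈ freeRegion d, HasDerivAt (deriv u) (-((E : ℂ) * u x)) x
  matching : ∀ n : ℤ, MatchesAt Λ u (site d n)
  quasiperiodic : ∀ x ∈ freeRegion d, u (x + d) = Complex.exp (θ * Complex.I) * u x
  nonzero : ∃ x ∈ freeRegion d, u x ≠ 0

end KronigPenney

/-!
The energy `E` enters only through the monodromy matrix `P`, which carries the vector `(u, u')` of
a solution of `-u'' = E u` with the matching conditions from the centre of one cell to the centre of
the next. It is unimodular, and its trace is the real discriminant `D(E)`.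

*Energies with `|D(E)| > 2` are regular.* By Cayley–Hamilton, `P + P⁻¹ = D`, so every homogeneous
solution satisfies `u(x + d) + u(x - d) = D u(x)` (`add_sub_eq_discriminant_mul`). For a solution of
`-u'' - E u = g` obtained by variation of constants, which need not be square integrable,
`w(x) = u(x + d) + u(x - d) - D u(x)` is therefore controlled by the integral of `|g|` over
`[x - d, x + d]` (`IsCoeff.exists_shift_bound`), so it is in `L²` whenever `g` is; it solves the
equation with the inhomogeneity `g(x + d) + g(x - d) - D g(x)` (`IsCoeff.shift`). The sum of the two
translations has norm at most `2` on `L²`, so if `|D| > 2` every `f` in `L²` has the form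
`g(x + d) + g(x - d) - D g(x)` with `g` in `L²`, depending boundedly on `f`. This gives the
resolvent, and the same estimate gives its uniqueness (`isRegularPoint_of_two_lt`).

*The bottom of the spectrum.* If `β > 0`, or `β = 0` and `γ > 0`, then `D(E) > 2` far below zero,
while `D` has a zero. So there is a lowest energy `E₀` with `D(E₀) ≤ 2`, and `D(E₀) = 2`
(`exists_discriminant_eq_two`). In the remaining cases `-D` takes the place of `D`, and
`D(E₀) = -2`. So `D(E₀) = 2 s` with a sign `s`, and `s` is an eigenvalue of `P`. The corresponding
Bloch solution is bounded; its cutoffs to `N` cells have norms that grow with `N`, but images under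
`h_Λ - E₀` with bounded norms, since only the two edges contribute. Hence `E₀` is in the spectrum
(`not_isRegularPoint_of_eigenvector`), and it is the minimum of the spectrum.

*The multiplier.* The multiplier `m` of a Bloch solution at `E₀` satisfies `m + m⁻¹ = D(E₀) = 2 s`,
hence `m = s` (`bottom_of_discriminant`).
-/

namespace KronigPenney

/-! ### The fundamental system of the free equation -/

/-- The solution of `-u'' = E u` with `u(0) = 1`, `u'(0) = 0`: one of the two factors is `1`, since
`√E` or `√(-E)` vanishes. -/
noncomputable def freeCos (E s : ℝ) : ℝ := Real.cos (√E * s) * Real.cosh (√(-E) * s)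

/-- The solution of `-u'' = E u` with `u(0) = 0`, `u'(0) = 1`. The divided slopes `sin x / x` and
`sinh x / x`, extended by `1` at the origin, make the continuity in `E` at `E = 0` visible. -/
noncomputable def freeSin (E s : ℝ) : ℝ :=
  s * dslope Real.sin 0 (√E * s) * dslope Real.sinh 0 (√(-E) * s)

theorem continuous_dslope_zero {f : ℝ → ℝ} (hf : Differentiable ℝ f) :
    Continuous (dslope f 0) := by
  have h := (continuousOn_dslope (f := f) (a := (0 : ℝ)) (s := Set.univ) univ_mem).2
    ⟨hf.continuous.continuousOn, hf 0⟩
  exact continuousOn_univ.1 h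

theorem continuous_freeCos (s : ℝ) : Continuous fun E => freeCos E s := by
  unfold freeCos; fun_prop

theorem continuous_freeSin (s : ℝ) : Continuous fun E => freeSin E s := by
  have h1 := continuous_dslope_zero Real.differentiable_sin
  have h2 := continuous_dslope_zero Real.differentiable_sinh
  unfold freeSin; fun_prop

theorem freeCos_of_nonneg {E : ℝ} (hE : 0 ≤ E) (s : ℝ) : freeCos E s = Real.cos (√E * s) := by
  simp [freeCos, Real.sqrt_eq_zero_of_nonpos (neg_nonpos.2 hE)]

theorem freeCos_of_nonpos {E : ℝ} (hE : E ≤ 0) (s : ℝ) :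
    freeCos E s = Real.cosh (√(-E) * s) := by
  simp [freeCos, Real.sqrt_eq_zero_of_nonpos hE]

theorem freeSin_zero_left (s : ℝ) : freeSin 0 s = s := by
  simp [freeSin, dslope_same]

theorem freeSin_of_pos {E : ℝ} (hE : 0 < E) (s : ℝ) :
    freeSin E s = Real.sin (√E * s) / √E := by
  have h : √E ≠ 0 := (Real.sqrt_pos.2 hE).ne'
  have h1 := sub_smul_dslope Real.sin 0 (√E * s)
  simp only [sub_zero, smul_eq_mul, Real.sin_zero] at h1
  rw [freeSin, Real.sqrt_eq_zero_of_nonpos (neg_nonpos.2 hE.le), zero_mul, dslope_same,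
    Real.deriv_sinh, Real.cosh_zero, ← h1]
  field_simp

theorem freeSin_of_neg {E : ℝ} (hE : E < 0) (s : ℝ) :
    freeSin E s = Real.sinh (√(-E) * s) / √(-E) := by
  have h : √(-E) ≠ 0 := (Real.sqrt_pos.2 (neg_pos.2 hE)).ne'
  have h1 := sub_smul_dslope Real.sinh 0 (√(-E) * s)
  simp only [sub_zero, smul_eq_mul, Real.sinh_zero] at h1
  rw [freeSin, Real.sqrt_eq_zero_of_nonpos hE.le, zero_mul, dslope_same,
    Real.deriv_sin, Real.cos_zero, ← h1]
  field_simp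

@[simp] theorem freeCos_zero (E : ℝ) : freeCos E 0 = 1 := by simp [freeCos]

@[simp] theorem freeSin_zero (E : ℝ) : freeSin E 0 = 0 := by simp [freeSin]

theorem freeCos_neg (E s : ℝ) : freeCos E (-s) = freeCos E s := by simp [freeCos]

theorem hasDerivAt_freeCos (E s : ℝ) : HasDerivAt (freeCos E) (-(E * freeSin E s)) s := by
  rcases lt_trichotomy E 0 with hE | rfl | hE
  · have h : √(-E) ≠ 0 := (Real.sqrt_pos.2 (neg_pos.2 hE)).ne'
    have h2 : √(-E) ^ 2 = -E := Real.sq_sqrt (neg_pos.2 hE).le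
    have h1 := ((hasDerivAt_id s).const_mul √(-E)).cosh
    rw [show freeCos E = fun s => Real.cosh (√(-E) * s) from funext (freeCos_of_nonpos hE.le),
      freeSin_of_neg hE]
    convert! h1 using 1
    field_simp
    simp only [id]
    rw [h2]; ring
  · rw [show freeCos 0 = fun _ => 1 by ext s; simp [freeCos]]
    simpa using hasDerivAt_const s (1 : ℝ)
  · have h : √E ≠ 0 := (Real.sqrt_pos.2 hE).ne'
    have h2 : √E ^ 2 = E := Real.sq_sqrt hE.le
    have h1 := ((hasDerivAt_id s).const_mul √E).cos
    rw [show freeCos E = fun s => Real.cos (√E * s) from funext (freeCos_of_nonneg hE.le),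
      freeSin_of_pos hE]
    convert! h1 using 1
    field_simp
    simp only [id]
    rw [h2]

theorem hasDerivAt_freeSin (E s : ℝ) : HasDerivAt (freeSin E) (freeCos E s) s := by
  rcases lt_trichotomy E 0 with hE | rfl | hE
  · have h : √(-E) ≠ 0 := (Real.sqrt_pos.2 (neg_pos.2 hE)).ne'
    have h1 := (((hasDerivAt_id s).const_mul √(-E)).sinh).div_const √(-E)
    rw [show freeSin E = _ from funext (freeSin_of_neg hE), freeCos_of_nonpos hE.le]
    convert! h1 using 1
    simp only [id]
    field_simp
  · rw [show freeSin 0 = _ from funext freeSin_zero_left]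
    simpa [freeCos] using hasDerivAt_id' s
  · have h : √E ≠ 0 := (Real.sqrt_pos.2 hE).ne'
    have h1 := (((hasDerivAt_id s).const_mul √E).sin).div_const √E
    rw [show freeSin E = _ from funext (freeSin_of_pos hE), freeCos_of_nonneg hE.le]
    convert! h1 using 1
    simp only [id]
    field_simp

theorem freeSin_neg (E s : ℝ) : freeSin E (-s) = -freeSin E s := by
  rcases lt_trichotomy E 0 with hE | rfl | hE
  · simp [freeSin_of_neg hE, neg_div]
  · simp [freeSin_zero_left]
  · simp [freeSin_of_pos hE, neg_div]

theorem freeCos_sq_add (E s : ℝ) : freeCos E s ^ 2 + E * freeSin E s ^ 2 = 1 := by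
  rcases lt_trichotomy E 0 with hE | rfl | hE
  · have h : √(-E) ≠ 0 := (Real.sqrt_pos.2 (neg_pos.2 hE)).ne'
    have h2 : √(-E) ^ 2 = -E := Real.sq_sqrt (neg_pos.2 hE).le
    rw [freeSin_of_neg hE, freeCos_of_nonpos hE.le, div_pow, h2, Real.sinh_sq]
    field_simp [hE.ne]; ring
  · simp [freeCos]
  · have h : √E ≠ 0 := (Real.sqrt_pos.2 hE).ne'
    have h2 : √E ^ 2 = E := Real.sq_sqrt hE.le
    rw [freeSin_of_pos hE, freeCos_of_nonneg hE.le, div_pow, h2, Real.sin_sq]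
    field_simp; ring

theorem freeCos_add (E s t : ℝ) :
    freeCos E (s + t) = freeCos E s * freeCos E t - E * freeSin E s * freeSin E t := by
  rcases lt_trichotomy E 0 with hE | rfl | hE
  · have h : √(-E) ≠ 0 := (Real.sqrt_pos.2 (neg_pos.2 hE)).ne'
    have h2 : √(-E) ^ 2 = -E := Real.sq_sqrt (neg_pos.2 hE).le
    simp only [freeSin_of_neg hE, freeCos_of_nonpos hE.le, mul_add, Real.cosh_add]
    field_simp
    rw [h2]; ring
  · simp [freeCos]
  · have h : √E ≠ 0 := (Real.sqrt_pos.2 hE).ne'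
    have h2 : √E ^ 2 = E := Real.sq_sqrt hE.le
    simp only [freeSin_of_pos hE, freeCos_of_nonneg hE.le, mul_add, Real.cos_add]
    field_simp
    rw [h2]; ring

theorem freeSin_add (E s t : ℝ) :
    freeSin E (s + t) = freeSin E s * freeCos E t + freeCos E s * freeSin E t := by
  rcases lt_trichotomy E 0 with hE | rfl | hE
  · simp only [freeSin_of_neg hE, freeCos_of_nonpos hE.le, mul_add, Real.sinh_add]
    ring
  · simp [freeCos, freeSin_zero_left]
  · simp only [freeSin_of_pos hE, freeCos_of_nonneg hE.le, mul_add, Real.sin_add]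
    ring

/-! ### The discriminant -/

/-- The discriminant (trace of the monodromy matrix) of the Kronig–Penney equation. -/
noncomputable def discriminant (d α β γ δ E : ℝ) : ℝ :=
  (γ + δ) * freeCos E d + (α - β * E) * freeSin E d

theorem continuous_discriminant (d α β γ δ : ℝ) : Continuous (discriminant d α β γ δ) := by
  have h1 := continuous_freeCos d
  have h2 := continuous_freeSin d
  unfold discriminant; fun_prop

/-- At the energies `(π/d)²` and `(2π/d)²` the discriminant is `∓(γ + δ)`, so it vanishes in
between. -/
theorem exists_discriminant_eq_zero {d : ℝ} (hd : 0 < d) (α β γ δ : ℝ) :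
    ∃ E, discriminant d α β γ δ E = 0 := by
  have key : ∀ k : ℝ, 0 < k → Real.sin (k * Real.pi) = 0 →
      discriminant d α β γ δ ((k * Real.pi / d) ^ 2) = (γ + δ) * Real.cos (k * Real.pi) := by
    intro k hk hs
    have hp : 0 < k * Real.pi / d := by positivity
    have e : k * Real.pi / d * d = k * Real.pi := by field_simp
    rw [discriminant, freeCos_of_nonneg (by positivity), freeSin_of_pos (by positivity),
      Real.sqrt_sq hp.le, e, hs]
    simp
  have h1 := key 1 one_pos (by simp)
  have h2 := key 2 two_pos (by simp)
  simp only [one_mul, Real.cos_pi, Real.cos_two_pi] at h1 h2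
  have hc := continuous_discriminant d α β γ δ
  have hmem : (0 : ℝ) ∈ Set.uIcc (discriminant d α β γ δ ((Real.pi / d) ^ 2))
      (discriminant d α β γ δ ((2 * Real.pi / d) ^ 2)) := by
    rw [h1, h2, Set.mem_uIcc]
    rcases le_total 0 (γ + δ) with h | h
    · left; constructor <;> linarith
    · right; constructor <;> linarith
  obtain ⟨E, -, hE⟩ := intermediate_value_uIcc hc.continuousOn hmem
  exact ⟨E, hE⟩

/-- Far below zero the discriminant is large, with the sign of `β`, or of `γ` if `β = 0`. -/
theorem exists_forall_le_two_lt_discriminant {d : ℝ} (hd : 0 < d) {α β γ δ : ℝ}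
    (hdet : α * β - γ * δ = -1) (h : 0 < β ∨ (β = 0 ∧ 0 < γ)) :
    ∃ E₀, ∀ E ≤ E₀, 2 < discriminant d α β γ δ E := by
  -- `L` is chosen such that every `κ = √(-E) ≥ L` satisfies the estimates needed below
  obtain ⟨L, hL1, hL2, hL3, hL4⟩ : ∃ L : ℝ, 1 ≤ L ∧ 2 ≤ L * d ∧ |α| ≤ L ∧
      (0 < β → |α| + 2 * (|γ + δ| + 3) ≤ β * L) := by
    refine ⟨1 + 2 / d + |α| + |(|α| + 2 * (|γ + δ| + 3)) / β|, ?_, ?_, ?_, ?_⟩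
    · have : 0 ≤ 2 / d := by positivity
      linarith [abs_nonneg α, abs_nonneg ((|α| + 2 * (|γ + δ| + 3)) / β)]
    · have : 2 / d * d = 2 := by field_simp
      nlinarith [abs_nonneg α, abs_nonneg ((|α| + 2 * (|γ + δ| + 3)) / β),
        mul_nonneg (abs_nonneg α) hd.le,
        mul_nonneg (abs_nonneg ((|α| + 2 * (|γ + δ| + 3)) / β)) hd.le]
    · have : 0 ≤ 2 / d := by positivity
      linarith [abs_nonneg ((|α| + 2 * (|γ + δ| + 3)) / β)]
    · intro hβ
      have h0 : 0 ≤ 2 / d := by positivity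
      have h1 : β * ((|α| + 2 * (|γ + δ| + 3)) / β) = |α| + 2 * (|γ + δ| + 3) := by field_simp
      have h2 := le_abs_self ((|α| + 2 * (|γ + δ| + 3)) / β)
      calc |α| + 2 * (|γ + δ| + 3) = β * ((|α| + 2 * (|γ + δ| + 3)) / β) := h1.symm
        _ ≤ _ := by
          apply mul_le_mul_of_nonneg_left _ hβ.le
          linarith [abs_nonneg α]
  refine ⟨-L ^ 2, fun E hE => ?_⟩
  have hE0 : E < 0 := by nlinarith
  obtain ⟨κ, hκ⟩ : ∃ κ, κ = √(-E) := ⟨_, rfl⟩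
  have hκ2 : κ ^ 2 = -E := by rw [hκ]; exact Real.sq_sqrt (by linarith)
  have hκ0 : 0 ≤ κ := hκ ▸ Real.sqrt_nonneg _
  have hLκ : L ≤ κ := by nlinarith
  have hκpos : 0 < κ := by linarith
  have hx : 2 ≤ κ * d := by nlinarith
  have hexp : 1 + κ * d + (κ * d) ^ 2 / 2 ≤ Real.exp (κ * d) :=
    Real.quadratic_le_exp_of_nonneg (by linarith)
  have hexpn : Real.exp (-(κ * d)) ≤ 1 := Real.exp_le_one_iff.2 (by linarith)
  have hexpn0 := Real.exp_pos (-(κ * d))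
  have hcosh := Real.cosh_eq (κ * d)
  have hsinh := Real.sinh_eq (κ * d)
  have hc2 : 2 < Real.cosh (κ * d) := by rw [hcosh]; nlinarith
  have hs2 : Real.cosh (κ * d) ≤ 2 * Real.sinh (κ * d) := by rw [hcosh, hsinh]; nlinarith
  have hsc : Real.sinh (κ * d) ≤ Real.cosh (κ * d) := by rw [hcosh, hsinh]; linarith
  have hs0 : 0 ≤ Real.sinh (κ * d) := by linarith
  have hD : discriminant d α β γ δ E =
      (γ + δ) * Real.cosh (κ * d) + (α / κ + β * κ) * Real.sinh (κ * d) := by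
    rw [discriminant, freeCos_of_nonpos hE0.le, freeSin_of_neg hE0, ← hκ,
      show E = -κ ^ 2 by linarith]
    field_simp; ring
  have hακ : -|α| ≤ α / κ := by
    rw [le_div_iff₀ hκpos]
    nlinarith [neg_abs_le α, abs_nonneg α]
  have hακ1 : -1 ≤ α / κ := by
    rw [le_div_iff₀ hκpos]
    linarith [neg_abs_le α]
  rw [hD]
  rcases h with hβ | ⟨rfl, hγ⟩
  · have h1 : β * L ≤ β * κ := mul_le_mul_of_nonneg_left hLκ hβ.le
    have h2 : 2 * (|γ + δ| + 3) ≤ α / κ + β * κ := by linarith [hL4 hβ]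
    have h3 := mul_le_mul_of_nonneg_right h2 hs0
    have h4 := neg_abs_le (γ + δ)
    have h5 := mul_le_mul_of_nonneg_right h4 (by linarith : (0 : ℝ) ≤ Real.cosh (κ * d))
    have h6 := mul_le_mul_of_nonneg_left hs2 (by positivity : (0 : ℝ) ≤ |γ + δ| + 3)
    nlinarith
  · have hγδ : γ * δ = 1 := by linarith
    have hδ : 0 < δ := by
      by_contra hcon
      nlinarith
    have h1 : 2 ≤ γ + δ := by nlinarith [sq_nonneg (γ - δ)]
    have h2 := mul_le_mul_of_nonneg_right h1 (by linarith : (0 : ℝ) ≤ Real.cosh (κ * d))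
    have h3 := mul_le_mul_of_nonneg_right hακ1 hs0
    rw [zero_mul, add_zero]
    linarith

theorem discriminant_neg (d α β γ δ E : ℝ) :
    discriminant d (-α) (-β) (-γ) (-δ) E = -discriminant d α β γ δ E := by
  simp only [discriminant]; ring

/-- The lowest energy with `|D(E)| ≤ 2`: there the discriminant is `2`. -/
theorem exists_discriminant_eq_two {d : ℝ} (hd : 0 < d) {α β γ δ : ℝ}
    (hdet : α * β - γ * δ = -1) (h : 0 < β ∨ (β = 0 ∧ 0 < γ)) :
    ∃ E₀, discriminant d α β γ δ E₀ = 2 ∧ ∀ E < E₀, 2 < discriminant d α β γ δ E := by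
  have hc := continuous_discriminant d α β γ δ
  obtain ⟨L, hL⟩ := exists_forall_le_two_lt_discriminant hd hdet h
  obtain ⟨Ez, hEz⟩ := exists_discriminant_eq_zero hd α β γ δ
  -- `D` exceeds `2` far below zero and vanishes somewhere, so this closed set has a minimum
  set S : Set ℝ := {E | discriminant d α β γ δ E ≤ 2} with hS
  have hSc : IsClosed S := isClosed_le hc continuous_const
  have hSn : S.Nonempty := ⟨Ez, by simp [hS, hEz]⟩
  have hSb : BddBelow S := ⟨L, fun E hE => by
    by_contra hlt
    exact absurd (hL E (not_le.1 hlt).le) (not_lt.2 hE)⟩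
  have hlt : ∀ E < sInf S, 2 < discriminant d α β γ δ E := fun E hE => by
    by_contra hcon
    exact absurd (csInf_le hSb (show E ∈ S from not_lt.1 hcon)) (not_le.2 hE)
  refine ⟨sInf S, le_antisymm (hSc.csInf_mem hSn hSb) ?_, hlt⟩
  have ht : Tendsto (discriminant d α β γ δ) (𝓝[<] (sInf S))
      (𝓝 (discriminant d α β γ δ (sInf S))) := hc.continuousAt.tendsto.mono_left inf_le_left
  refine ge_of_tendsto ht ?_
  filter_upwards [self_mem_nhdsWithin] with E hE using (hlt E hE).le

/-! ### Absolutely continuous functions with values in `ℂ` -/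

theorem _root_.MeasureTheory.LocallyIntegrable.intervalIntegrable
    {F : Type*} [NormedAddCommGroup F] {f : ℝ → F}
    (hf : LocallyIntegrable f) (a b : ℝ) : IntervalIntegrable f volume a b :=
  (hf.integrableOn_isCompact isCompact_uIcc).intervalIntegrable

theorem _root_.AbsolutelyContinuousOnInterval.congr_eqOn {f g : ℝ → ℂ} {a b : ℝ}
    (hf : AbsolutelyContinuousOnInterval f a b) (h : Set.EqOn f g (Set.uIcc a b)) :
    AbsolutelyContinuousOnInterval g a b := by
  refine (tendsto_congr' ?_).1 hf
  filter_upwards [mem_inf_of_right (mem_principal_self _)] with I hI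
  refine Finset.sum_congr rfl fun i hi => ?_
  rw [h (hI.1 i hi).1, h (hI.1 i hi).2]

theorem absolutelyContinuousOnInterval_integral {f : ℝ → ℂ} (hf : LocallyIntegrable f)
    (c a b : ℝ) : AbsolutelyContinuousOnInterval (fun x => ∫ t in c..x, f t) a b := by
  have h := (hf.intervalIntegrable a b).norm.absolutelyContinuousOnInterval_intervalIntegral
    Set.left_mem_uIcc
  refine squeeze_zero (fun I => Finset.sum_nonneg fun i _ => dist_nonneg) (fun I => ?_) h
  refine Finset.sum_le_sum fun i _ => ?_
  have hn : ∀ x y, IntervalIntegrable (fun t => ‖f t‖) volume x y := fun x y =>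
    (hf.intervalIntegrable x y).norm
  rw [dist_comm, dist_comm (∫ v in a..(I.2 i).1, ‖f v‖), dist_eq_norm, dist_eq_norm,
    intervalIntegral.integral_interval_sub_left (hf.intervalIntegrable _ _)
      (hf.intervalIntegrable _ _),
    intervalIntegral.integral_interval_sub_left (hn _ _) (hn _ _)]
  exact intervalIntegral.norm_integral_le_abs_integral_norm

/-- The fundamental theorem of calculus for absolutely continuous functions. -/
theorem _root_.AbsolutelyContinuousOnInterval.sub_eq_integral {f g : ℝ → ℂ} {a b : ℝ}
    (hf : AbsolutelyContinuousOnInterval f a b)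
    (hd : ∀ᵐ x, x ∈ Set.uIcc a b → HasDerivAt f (g x) x) (hg : LocallyIntegrable g) :
    f b - f a = ∫ t in a..b, g t := by
  have h1 := hf.sub (absolutelyContinuousOnInterval_integral hg a a b)
  obtain ⟨C, hC⟩ := h1.const_of_ae_hasDerivAt_zero (by
    filter_upwards [hd, LocallyIntegrable.ae_hasDerivAt_integral hg] with x hx hx2 hmem
    simpa using (hx hmem).sub (hx2 a))
  have ha := hC a Set.left_mem_uIcc
  have hb := hC b Set.right_mem_uIcc
  simp only [Pi.sub_apply, intervalIntegral.integral_same, sub_zero] at ha hb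
  rw [ha, ← hb]; ring

/-! ### Variation of constants on the line -/

theorem hasDerivAt_freeCos_ofReal (E a x : ℝ) :
    HasDerivAt (fun x : ℝ => (freeCos E (x - a) : ℂ)) (-(E * freeSin E (x - a))) x := by
  have h := ((hasDerivAt_freeCos E (x - a)).comp_sub_const x a).ofReal_comp
  simpa using h

theorem hasDerivAt_freeSin_ofReal (E a x : ℝ) :
    HasDerivAt (fun x : ℝ => (freeSin E (x - a) : ℂ)) (freeCos E (x - a)) x :=
  ((hasDerivAt_freeSin E (x - a)).comp_sub_const x a).ofReal_comp

theorem continuous_freeCos_right (E : ℝ) : Continuous (freeCos E) :=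
  continuous_iff_continuousAt.2 fun s => (hasDerivAt_freeCos E s).continuousAt

theorem continuous_freeSin_right (E : ℝ) : Continuous (freeSin E) :=
  continuous_iff_continuousAt.2 fun s => (hasDerivAt_freeSin E s).continuousAt

theorem absolutelyContinuousOnInterval_of_hasDerivAt {f f' : ℝ → ℂ} {a b : ℝ}
    (h : ∀ x ∈ Set.uIcc a b, HasDerivAt f (f' x) x) (hf' : ContinuousOn f' (Set.uIcc a b)) :
    AbsolutelyContinuousOnInterval f a b := by
  obtain ⟨C, hC⟩ := isCompact_uIcc.exists_bound_of_continuousOn hf'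
  have hL : LipschitzOnWith C.toNNReal f (Set.uIcc a b) := by
    refine (convex_uIcc a b).lipschitzOnWith_of_nnnorm_hasDerivWithin_le
      (fun x hx => (h x hx).hasDerivWithinAt) fun x hx => ?_
    rw [← NNReal.coe_le_coe, coe_nnnorm]
    exact (hC x hx).trans (Real.le_coe_toNNReal C)
  exact hL.absolutelyContinuousOnInterval

/-- The solution of `-u'' = E u + f` with `u(a) = k₀`, `u'(a) = k₁`, and its derivative. -/
noncomputable def duhamel (E a : ℝ) (f : ℝ → ℂ) (k : Fin 2 → ℂ) (x : ℝ) : Fin 2 → ℂ :=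
  ![freeCos E (x - a) * (k 0 + ∫ s in a..x, freeSin E (s - a) * f s)
      + freeSin E (x - a) * (k 1 + ∫ s in a..x, -(freeCos E (s - a) * f s)),
    -(E * freeSin E (x - a)) * (k 0 + ∫ s in a..x, freeSin E (s - a) * f s)
      + freeCos E (x - a) * (k 1 + ∫ s in a..x, -(freeCos E (s - a) * f s))]

theorem locallyIntegrable_freeSin_mul (E a : ℝ) {f : ℝ → ℂ} (hf : LocallyIntegrable f) :
    LocallyIntegrable fun s => (freeSin E (s - a) : ℂ) * f s :=
  hf.continuous_mul (Complex.continuous_ofReal.comp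
    ((continuous_freeSin_right E).comp (continuous_id.sub continuous_const)))

theorem locallyIntegrable_freeCos_mul (E a : ℝ) {f : ℝ → ℂ} (hf : LocallyIntegrable f) :
    LocallyIntegrable fun s => -((freeCos E (s - a) : ℂ) * f s) :=
  (hf.continuous_mul (Complex.continuous_ofReal.comp
    ((continuous_freeCos_right E).comp (continuous_id.sub continuous_const)))).neg

theorem duhamel_ac (E a : ℝ) {f : ℝ → ℂ} (hf : LocallyIntegrable f)
    (k : Fin 2 → ℂ) (i : Fin 2) (b c : ℝ) :
    AbsolutelyContinuousOnInterval (fun x => duhamel E a f k x i) b c := by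
  have h0 := (absolutelyContinuousOnInterval_of_hasDerivAt (a := b) (b := c)
    (fun x _ => hasDerivAt_const x (k 0)) continuousOn_const).fun_add
    (absolutelyContinuousOnInterval_integral (locallyIntegrable_freeSin_mul E a hf) a b c)
  have h1 := (absolutelyContinuousOnInterval_of_hasDerivAt (a := b) (b := c)
    (fun x _ => hasDerivAt_const x (k 1)) continuousOn_const).fun_add
    (absolutelyContinuousOnInterval_integral (locallyIntegrable_freeCos_mul E a hf) a b c)
  have cC : Continuous fun x : ℝ => (freeCos E (x - a) : ℂ) := Complex.continuous_ofReal.comp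
    ((continuous_freeCos_right E).comp (continuous_id.sub continuous_const))
  have cS : Continuous fun x : ℝ => (freeSin E (x - a) : ℂ) := Complex.continuous_ofReal.comp
    ((continuous_freeSin_right E).comp (continuous_id.sub continuous_const))
  have hC := absolutelyContinuousOnInterval_of_hasDerivAt (a := b) (b := c)
    (fun x _ => hasDerivAt_freeCos_ofReal E a x) (continuous_const.mul cS).neg.continuousOn
  have hS := absolutelyContinuousOnInterval_of_hasDerivAt (a := b) (b := c)
    (fun x _ => hasDerivAt_freeSin_ofReal E a x) cC.continuousOn
  have hES := (hS.const_smul (E : ℂ)).fun_neg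
  fin_cases i
  · exact (hC.smul h0).fun_add (hS.smul h1)
  · exact (hES.smul h0).fun_add (hC.smul h1)

theorem duhamel_ae_hasDerivAt (E a : ℝ) {f : ℝ → ℂ} (hf : LocallyIntegrable f)
    (k : Fin 2 → ℂ) :
    ∀ᵐ x, HasDerivAt (fun x => duhamel E a f k x 0) (duhamel E a f k x 1) x ∧
      HasDerivAt (fun x => duhamel E a f k x 1) (-(f x + E * duhamel E a f k x 0)) x := by
  filter_upwards [LocallyIntegrable.ae_hasDerivAt_integral (locallyIntegrable_freeSin_mul E a hf),
    LocallyIntegrable.ae_hasDerivAt_integral (locallyIntegrable_freeCos_mul E a hf)] with x h0 h1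
  have h0 := (h0 a).const_add (k 0)
  have h1 := (h1 a).const_add (k 1)
  have hC := hasDerivAt_freeCos_ofReal E a x
  have hS := hasDerivAt_freeSin_ofReal E a x
  have hsq : (freeCos E (x - a) : ℂ) ^ 2 + E * (freeSin E (x - a) : ℂ) ^ 2 = 1 := by
    exact_mod_cast freeCos_sq_add E (x - a)
  constructor
  · convert! (hC.mul h0).add (hS.mul h1) using 1
    simp only [duhamel, Matrix.cons_val_one, Matrix.cons_val_zero]
    ring
  · convert! ((hS.const_mul (E : ℂ)).fun_neg.mul h0).add (hC.mul h1) using 1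
    simp only [duhamel, Matrix.cons_val_zero]
    linear_combination f x * hsq

/-- The first component is differentiable everywhere, although the variable coefficients are so
only almost everywhere. -/
theorem hasDerivAt_duhamel (E a : ℝ) {f : ℝ → ℂ} (hf : LocallyIntegrable f)
    (k : Fin 2 → ℂ) (x : ℝ) :
    HasDerivAt (fun x => duhamel E a f k x 0) (duhamel E a f k x 1) x := by
  have hc : Continuous fun x => duhamel E a f k x 1 := by
    rw [continuous_iff_continuousAt]
    intro y
    refine (duhamel_ac E a hf k 1 (y - 1) (y + 1)).continuousOn.continuousAt ?_
    rw [Set.uIcc_of_le (by linarith)]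
    exact Icc_mem_nhds (by linarith) (by linarith)
  have h : ∀ y, duhamel E a f k y 0 = duhamel E a f k a 0 + ∫ t in a..y, duhamel E a f k t 1 := by
    intro y
    rw [← (duhamel_ac E a hf k 0 a y).sub_eq_integral ?_ hc.locallyIntegrable]
    · ring
    · filter_upwards [duhamel_ae_hasDerivAt E a hf k] with t ht _ using ht.1
  rw [show (fun x => duhamel E a f k x 0) = _ from funext h]
  exact (hc.integral_hasStrictDerivAt a x).hasDerivAt.const_add _

/-! ### Cells -/

/-- The index `n` of the cell `[nd - d/2, nd + d/2)` that contains `x`. -/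
noncomputable def cellIndex (d x : ℝ) : ℤ := ⌊x / d + 1 / 2⌋

/-- The open cell between the sites `x_{n-1}` and `x_n`. -/
def cell (d : ℝ) (n : ℤ) : Set ℝ := Set.Ioo (n * d - d / 2) (n * d + d / 2)

section cells

variable {d : ℝ}

theorem cellIndex_eq_iff (hd : 0 < d) {x : ℝ} {n : ℤ} :
    cellIndex d x = n ↔ n * d - d / 2 ≤ x ∧ x < n * d + d / 2 := by
  have e : (x / d) * d = x := by field_simp
  rw [cellIndex, Int.floor_eq_iff]
  constructor
  · rintro ⟨h1, h2⟩
    constructor <;> nlinarith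
  · rintro ⟨h1, h2⟩
    constructor
    · by_contra hcon
      nlinarith
    · by_contra hcon
      nlinarith

theorem cellIndex_spec (hd : 0 < d) (x : ℝ) :
    cellIndex d x * d - d / 2 ≤ x ∧ x < cellIndex d x * d + d / 2 :=
  (cellIndex_eq_iff hd).1 rfl

theorem cellIndex_of_mem_cell (hd : 0 < d) {x : ℝ} {n : ℤ} (hx : x ∈ cell d n) :
    cellIndex d x = n :=
  (cellIndex_eq_iff hd).2 ⟨hx.1.le, hx.2⟩

theorem cellIndex_add (hd : 0 < d) (x : ℝ) : cellIndex d (x + d) = cellIndex d x + 1 := by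
  have h := cellIndex_spec hd x
  rw [cellIndex_eq_iff hd]
  push_cast
  constructor <;> linarith [h.1, h.2]

theorem mem_freeRegion_iff (hd : 0 < d) {x : ℝ} :
    x ∈ freeRegion d ↔ x ∈ cell d (cellIndex d x) := by
  have h := cellIndex_spec hd x
  constructor
  · intro hx
    refine ⟨lt_of_le_of_ne h.1 fun he => hx ⟨cellIndex d x - 1, ?_⟩, h.2⟩
    rw [site]; push_cast; linarith
  · rintro hx ⟨m, rfl⟩
    simp only [site] at hx h
    obtain ⟨h1, h2⟩ := hx
    set n := cellIndex d (m * d + d / 2)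
    have h3 : ((n - 1 : ℤ) : ℝ) < m := by push_cast; nlinarith
    have h4 : (m : ℝ) < n := by nlinarith
    have h3' : n - 1 < m := by exact_mod_cast h3
    have h4' : m < n := by exact_mod_cast h4
    omega

theorem cell_subset_freeRegion (hd : 0 < d) (n : ℤ) : cell d n ⊆ freeRegion d := fun x hx => by
  rw [mem_freeRegion_iff hd, cellIndex_of_mem_cell hd hx]; exact hx

theorem add_mem_freeRegion_iff (hd : 0 < d) {x : ℝ} : x + d ∈ freeRegion d ↔ x ∈ freeRegion d := by
  rw [mem_freeRegion_iff hd, mem_freeRegion_iff hd, cellIndex_add hd]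
  simp only [cell, Set.mem_Ioo]
  push_cast
  constructor <;> rintro ⟨h1, h2⟩ <;> constructor <;> linarith

theorem sub_mem_freeRegion_iff (hd : 0 < d) {x : ℝ} : x - d ∈ freeRegion d ↔ x ∈ freeRegion d := by
  rw [← add_mem_freeRegion_iff hd, sub_add_cancel]

theorem isOpen_cell (d : ℝ) (n : ℤ) : IsOpen (cell d n) := isOpen_Ioo

/-- An interval without sites lies in one cell. -/
theorem exists_uIcc_subset_cell (hd : 0 < d) {a b : ℝ} (h : Set.uIcc a b ⊆ freeRegion d) :
    ∃ n, Set.uIcc a b ⊆ cell d n := by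
  wlog hab : a ≤ b generalizing a b
  · rw [Set.uIcc_comm] at h ⊢
    exact this h (le_of_not_ge hab)
  refine ⟨cellIndex d a, fun x hx => ?_⟩
  have ha := (mem_freeRegion_iff hd).1 (h Set.left_mem_uIcc)
  rw [Set.uIcc_of_le hab] at h hx
  refine ⟨ha.1.trans_le hx.1, lt_of_not_ge fun hcon => ?_⟩
  exact h ⟨ha.2.le, hcon.trans hx.2⟩ ⟨cellIndex d a, rfl⟩

theorem nhdsLT_site_mem_cell (hd : 0 < d) (n : ℤ) : ∀ᶠ x in 𝓝[<] (site d n), x ∈ cell d n :=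
  Ioo_mem_nhdsLT (by rw [site]; linarith)

theorem nhdsGT_site_mem_cell (hd : 0 < d) (n : ℤ) :
    ∀ᶠ x in 𝓝[>] (site d n), x ∈ cell d (n + 1) := by
  have h : Set.Ioo (site d n) (site d n + d) ∈ 𝓝[>] (site d n) := Ioo_mem_nhdsGT (by linarith)
  filter_upwards [h] with x hx
  simp only [site, Set.mem_Ioo] at hx
  simp only [cell, Set.mem_Ioo]
  push_cast
  constructor <;> linarith [hx.1, hx.2]

end cells

/-! ### Transfer matrices -/

/-- Unimodular complex `2 × 2` matrices. -/
abbrev SL2C : Type := Matrix.SpecialLinearGroup (Fin 2) ℂ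

theorem smul_apply_fin_two (g : SL2C) (v : Fin 2 → ℂ) (i : Fin 2) :
    (g • v) i = g.1 i 0 * v 0 + g.1 i 1 * v 1 := by
  rw [Matrix.SpecialLinearGroup.smul_def]
  change (g.1.mulVec v) i = _
  simp [Matrix.mulVec, dotProduct, Fin.sum_univ_two]

/-- The action of a unimodular matrix as a continuous linear map. -/
noncomputable def actionCLM (g : SL2C) : (Fin 2 → ℂ) →L[ℂ] (Fin 2 → ℂ) :=
  LinearMap.toContinuousLinearMap (DistribSMul.toLinearMap ℂ (Fin 2 → ℂ) g)

@[simp] theorem actionCLM_apply (g : SL2C) (v : Fin 2 → ℂ) : actionCLM g v = g • v := rfl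

/-- The Cayley–Hamilton theorem for unimodular matrices. -/
theorem smul_add_inv_smul (g : SL2C) (v : Fin 2 → ℂ) : g • v + g⁻¹ • v = g.1.trace • v := by
  ext i
  rw [Pi.add_apply, smul_apply_fin_two, smul_apply_fin_two, Matrix.SpecialLinearGroup.SL2_inv_expl,
    Matrix.trace_fin_two]
  fin_cases i <;> simp <;> ring

theorem inv_smul_eq (g : SL2C) (z : ℂ) :
    g⁻¹ • (![0, -z] : Fin 2 → ℂ) = ![g.1 0 1 * z, -(g.1 0 0 * z)] := by
  ext i
  rw [smul_apply_fin_two, Matrix.SpecialLinearGroup.SL2_inv_expl]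
  fin_cases i <;> simp

/-- The propagator of `-u'' = E u`. -/
noncomputable def propagator (E s : ℝ) : SL2C :=
  ⟨!![(freeCos E s : ℂ), (freeSin E s : ℂ); -((E : ℂ) * freeSin E s), (freeCos E s : ℂ)], by
    have h : (freeCos E s : ℂ) ^ 2 + E * (freeSin E s : ℂ) ^ 2 = 1 := by
      exact_mod_cast freeCos_sq_add E s
    rw [Matrix.det_fin_two_of]
    linear_combination h⟩

theorem propagator_add (E s t : ℝ) : propagator E (s + t) = propagator E s * propagator E t := by
  ext i j
  rw [Matrix.SpecialLinearGroup.coe_mul]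
  fin_cases i <;> fin_cases j <;>
    simp [propagator, freeCos_add, freeSin_add, Matrix.mul_apply, Fin.sum_univ_two] <;> ring

@[simp] theorem propagator_zero (E : ℝ) : propagator E 0 = 1 := by
  ext i j
  fin_cases i <;> fin_cases j <;> simp [propagator]

theorem propagator_neg (E s : ℝ) : propagator E (-s) = (propagator E s)⁻¹ := by
  rw [eq_inv_iff_mul_eq_one, ← propagator_add]; simp

theorem propagator_smul (E s : ℝ) (v : Fin 2 → ℂ) :
    propagator E s • v = ![freeCos E s * v 0 + freeSin E s * v 1,
      -(E * freeSin E s) * v 0 + freeCos E s * v 1] := by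
  ext i
  rw [smul_apply_fin_two]
  fin_cases i <;> simp [propagator]

theorem continuous_propagator_smul (E : ℝ) :
    Continuous fun p : ℝ × (Fin 2 → ℂ) => propagator E p.1 • p.2 := by
  have hC : Continuous fun p : ℝ × (Fin 2 → ℂ) => (freeCos E p.1 : ℂ) :=
    Complex.continuous_ofReal.comp ((continuous_freeCos_right E).comp continuous_fst)
  have hS : Continuous fun p : ℝ × (Fin 2 → ℂ) => (freeSin E p.1 : ℂ) :=
    Complex.continuous_ofReal.comp ((continuous_freeSin_right E).comp continuous_fst)
  simp only [propagator_smul]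
  refine continuous_pi fun i => ?_
  fin_cases i
  · simp only [Fin.zero_eta, Matrix.cons_val_zero]; fun_prop
  · simp only [Fin.mk_one, Matrix.cons_val_one]; fun_prop

/-- The propagators over a bounded range of distances are uniformly bounded. -/
theorem exists_propagator_bound (E r : ℝ) :
    ∃ B : ℝ, 0 ≤ B ∧ ∀ s, |s| ≤ r → ∀ v : Fin 2 → ℂ, ‖propagator E s • v‖ ≤ B * ‖v‖ := by
  have hc : Continuous fun s => |freeCos E s| + |freeSin E s| + |E * freeSin E s| := by
    have h1 := continuous_freeCos_right E
    have h2 := continuous_freeSin_right E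
    fun_prop
  obtain ⟨B, hB⟩ := (isCompact_Icc (a := -r) (b := r)).exists_bound_of_continuousOn hc.continuousOn
  refine ⟨|B|, abs_nonneg _, fun s hs v => ?_⟩
  have h1 : |freeCos E s| + |freeSin E s| + |E * freeSin E s| ≤ |B| :=
    (le_abs_self _).trans ((hB s (abs_le.1 hs)).trans (le_abs_self B))
  have hv0 := norm_le_pi_norm v 0
  have hv1 := norm_le_pi_norm v 1
  have e1 : ‖(freeCos E s : ℂ)‖ = |freeCos E s| := Complex.norm_real _
  have e2 : ‖(freeSin E s : ℂ)‖ = |freeSin E s| := Complex.norm_real _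
  have e3 : ‖-((E : ℂ) * freeSin E s)‖ = |E * freeSin E s| := by
    rw [norm_neg, ← Complex.ofReal_mul]; exact Complex.norm_real _
  have hn := norm_nonneg v
  have a1 := abs_nonneg (freeCos E s)
  have a2 := abs_nonneg (freeSin E s)
  have a3 := abs_nonneg (E * freeSin E s)
  rw [pi_norm_le_iff_of_nonneg (by positivity), propagator_smul]
  have key : ∀ z w : ℂ, ‖z‖ + ‖w‖ ≤ |B| → ‖z * v 0 + w * v 1‖ ≤ |B| * ‖v‖ := fun z w h => by
    refine (norm_add_le _ _).trans ?_
    rw [norm_mul, norm_mul]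
    calc _ ≤ ‖z‖ * ‖v‖ + ‖w‖ * ‖v‖ := by gcongr
      _ = (‖z‖ + ‖w‖) * ‖v‖ := by ring
      _ ≤ _ := by gcongr
  intro i
  fin_cases i
  · exact key _ _ (by rw [e1, e2]; linarith)
  · exact key _ _ (by rw [e3, e1]; linarith)

/-- The monodromy matrix, from the centre of a cell to the centre of the next one. -/
noncomputable def monodromy (d : ℝ) (Λ : SL2C) (E : ℝ) : SL2C :=
  propagator E (d / 2) * Λ * propagator E (d / 2)

theorem trace_monodromy {d α β γ δ : ℝ} {Λ : SL2C} (hΛ : Λ.1 = transferMatrix α β γ δ) (E : ℝ) :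
    (monodromy d Λ E).1.trace = discriminant d α β γ δ E := by
  have h1 : freeCos E d = freeCos E (d / 2) * freeCos E (d / 2)
      - E * freeSin E (d / 2) * freeSin E (d / 2) := by
    rw [← freeCos_add]; congr 1; ring
  have h2 : freeSin E d = freeSin E (d / 2) * freeCos E (d / 2)
      + freeCos E (d / 2) * freeSin E (d / 2) := by
    rw [← freeSin_add]; congr 1; ring
  rw [discriminant, h1, h2, monodromy, Matrix.SpecialLinearGroup.coe_mul,
    Matrix.SpecialLinearGroup.coe_mul]
  change Matrix.trace (_ * Λ.1 * _) = _
  rw [hΛ, Matrix.trace_fin_two]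
  simp [Matrix.mul_apply, Fin.sum_univ_two, propagator, transferMatrix]
  ring

/-- The fundamental matrix of the Kronig–Penney equation at the energy `E`, normalized at the
origin; at the sites its values are the limits from the right. -/
noncomputable def fundamental (d : ℝ) (Λ : SL2C) (E x : ℝ) : SL2C :=
  propagator E (x - cellIndex d x * d) * monodromy d Λ E ^ cellIndex d x

section fundamental

variable {d : ℝ} (Λ : SL2C) (E : ℝ)

theorem fundamental_of_mem_cell (hd : 0 < d) {n : ℤ} {x : ℝ} (hx : x ∈ cell d n) :
    fundamental d Λ E x = propagator E (x - n * d) * monodromy d Λ E ^ n := by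
  rw [fundamental, cellIndex_of_mem_cell hd hx]

theorem fundamental_add (hd : 0 < d) (x : ℝ) :
    fundamental d Λ E (x + d) = fundamental d Λ E x * monodromy d Λ E := by
  rw [fundamental, fundamental, cellIndex_add hd, zpow_add_one, ← mul_assoc]
  congr 3
  push_cast; ring

theorem fundamental_sub (hd : 0 < d) (x : ℝ) :
    fundamental d Λ E (x - d) = fundamental d Λ E x * (monodromy d Λ E)⁻¹ := by
  rw [eq_mul_inv_iff_mul_eq, ← fundamental_add Λ E hd, sub_add_cancel]

/-- The transfer matrices between points at distance at most `d` are uniformly bounded. -/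
theorem exists_fundamental_bound (hd : 0 < d) :
    ∃ B : ℝ, 0 ≤ B ∧ ∀ x y, |x - y| ≤ d → ∀ v : Fin 2 → ℂ,
      ‖(fundamental d Λ E x * (fundamental d Λ E y)⁻¹) • v‖ ≤ B * ‖v‖ := by
  obtain ⟨B, hB0, hB⟩ := exists_propagator_bound E (d / 2)
  set P := monodromy d Λ E with hP
  set C := ‖actionCLM P‖ + ‖actionCLM P⁻¹‖ + 1 with hC
  have hCk : ∀ k : ℤ, -1 ≤ k → k ≤ 1 → ∀ v : Fin 2 → ℂ, ‖P ^ k • v‖ ≤ C * ‖v‖ := by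
    intro k h1 h2 v
    have n0 := norm_nonneg (actionCLM P)
    have n1 := norm_nonneg (actionCLM P⁻¹)
    have nv := norm_nonneg v
    obtain rfl | rfl | rfl : k = -1 ∨ k = 0 ∨ k = 1 := by omega
    · rw [zpow_neg_one]
      refine ((actionCLM P⁻¹).le_opNorm v).trans ?_
      gcongr; linarith
    · rw [zpow_zero, one_smul, hC]; nlinarith [mul_nonneg n0 nv, mul_nonneg n1 nv]
    · rw [zpow_one]
      refine ((actionCLM P).le_opNorm v).trans ?_
      gcongr; linarith
  refine ⟨B * (C * B), by positivity, fun x y hxy v => ?_⟩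
  have hx := cellIndex_spec hd x
  have hy := cellIndex_spec hd y
  have hxy' := abs_le.1 hxy
  set n := cellIndex d x
  set m := cellIndex d y
  -- points at distance at most `d` lie in the same cell or in neighbouring cells
  have hk : -1 ≤ n - m ∧ n - m ≤ 1 := by
    have h1 : ((m - n : ℤ) : ℝ) < (2 : ℤ) := by push_cast; nlinarith
    have h2 : ((n - m : ℤ) : ℝ) < (2 : ℤ) := by push_cast; nlinarith
    have h1' := Int.cast_lt.1 h1
    have h2' := Int.cast_lt.1 h2
    omega
  have e : fundamental d Λ E x * (fundamental d Λ E y)⁻¹ =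
      propagator E (x - n * d) * (P ^ (n - m) * propagator E (-(y - m * d))) := by
    rw [fundamental, fundamental, propagator_neg, mul_inv_rev, zpow_sub]
    simp only [mul_assoc, n, m, P]
  rw [e, mul_smul, mul_smul]
  calc _ ≤ B * ‖P ^ (n - m) • propagator E (-(y - m * d)) • v‖ :=
        hB _ (abs_le.2 ⟨by linarith, by linarith⟩) _
    _ ≤ B * (C * ‖propagator E (-(y - m * d)) • v‖) := by
        gcongr; exact hCk _ hk.1 hk.2 _
    _ ≤ B * (C * (B * ‖v‖)) := by
        gcongr
        exact hB _ (by rw [abs_neg]; exact abs_le.2 ⟨by linarith, by linarith⟩) _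
    _ = _ := by ring

end fundamental

/-! ### Variation of constants across the sites -/

/-- The derivative of the coefficient vector `c` of a solution `U = Φ c` of `-u'' = E u + f`. -/
noncomputable def source (d : ℝ) (Λ : SL2C) (E : ℝ) (f : ℝ → ℂ) (s : ℝ) : Fin 2 → ℂ :=
  (fundamental d Λ E s)⁻¹ • ![0, -f s]

/-- `c` is the coefficient vector of a solution of `-u'' = E u + f` with the matching conditions:
the vector `(u, u')` is `Φ c`, where `Φ` is the fundamental matrix. -/
def IsCoeff (d : ℝ) (Λ : SL2C) (E : ℝ) (f : ℝ → ℂ) (c : ℝ → Fin 2 → ℂ) : Prop :=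
  ∀ x y, c y - c x = ∫ s in x..y, source d Λ E f s

section source

variable {d : ℝ} (Λ : SL2C) (E : ℝ) {f : ℝ → ℂ} {c : ℝ → Fin 2 → ℂ}

/-- In the `n`-th cell the source is, up to the constant matrix `Pⁿ`, the integrand of Duhamel's
formula. -/
theorem source_of_mem_cell (hd : 0 < d) {n : ℤ} {s : ℝ} (hs : s ∈ cell d n) (f : ℝ → ℂ) :
    monodromy d Λ E ^ n • source d Λ E f s =
      ![freeSin E (s - n * d) * f s, -(freeCos E (s - n * d) * f s)] := by
  rw [source, fundamental_of_mem_cell Λ E hd hs, mul_inv_rev, mul_smul, smul_inv_smul, inv_smul_eq]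
  simp [propagator]

theorem integrable_duhamel_source (hf : LocallyIntegrable f) (a : ℝ) {K : Set ℝ}
    (hK : IsCompact K) :
    IntegrableOn (fun s => (![freeSin E (s - a) * f s, -(freeCos E (s - a) * f s)] : Fin 2 → ℂ))
      K := by
  refine Integrable.of_eval fun i => ?_
  fin_cases i
  · exact (locallyIntegrable_freeSin_mul E a hf).integrableOn_isCompact hK
  · exact (locallyIntegrable_freeCos_mul E a hf).integrableOn_isCompact hK

theorem locallyIntegrable_source (hd : 0 < d) (hf : LocallyIntegrable f) :
    LocallyIntegrable (source d Λ E f) := by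
  have key : ∀ n : ℤ, IntegrableOn (source d Λ E f)
      (Set.Icc (n * d - d / 2) (n * d + d / 2)) := by
    intro n
    rw [integrableOn_Icc_iff_integrableOn_Ioo]
    have h := ((integrable_duhamel_source E hf (n * d)
      (isCompact_Icc (a := n * d - d / 2) (b := n * d + d / 2))).mono_set
      Set.Ioo_subset_Icc_self)
    refine ((actionCLM (monodromy d Λ E ^ n)⁻¹).integrable_comp h).congr ?_
    filter_upwards [self_mem_ae_restrict measurableSet_Ioo] with s hs
    rw [← source_of_mem_cell Λ E hd (n := n) hs f, actionCLM_apply, inv_smul_smul]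
  -- three consecutive closed cells form a neighbourhood of `x`
  intro x
  refine ⟨_, ?_, ((key (cellIndex d x - 1)).union (key (cellIndex d x))).union
    (key (cellIndex d x + 1))⟩
  have h := cellIndex_spec hd x
  refine mem_of_superset (Ioo_mem_nhds (show x - d < x by linarith) (show x < x + d by linarith))
    fun y hy => ?_
  simp only [Set.mem_union, Set.mem_Icc]
  push_cast
  rcases le_total y (cellIndex d x * d - d / 2) with h1 | h1
  · left; left
    constructor <;> linarith [hy.1, hy.2]
  · rcases le_total y (cellIndex d x * d + d / 2) with h2 | h2
    · left; right; exact ⟨h1, h2⟩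
    · right; constructor <;> linarith [hy.1, hy.2]

variable {Λ E}

theorem IsCoeff.continuous (hc : IsCoeff d Λ E f c) (hd : 0 < d) (hf : LocallyIntegrable f) :
    Continuous c := by
  rw [show c = fun x => c 0 + ∫ s in (0 : ℝ)..x, source d Λ E f s by
    ext1 x; rw [← hc 0 x]; abel]
  exact continuous_const.add
    (intervalIntegral.continuous_primitive (locallyIntegrable_source Λ E hd hf).intervalIntegrable
      0)

theorem isCoeff_integral (hd : 0 < d) (hf : LocallyIntegrable f) :
    IsCoeff d Λ E f fun x => ∫ s in (0 : ℝ)..x, source d Λ E f s := fun x y => by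
  have h := (locallyIntegrable_source Λ E hd hf).intervalIntegrable
  exact intervalIntegral.integral_interval_sub_left (h _ _) (h _ _)

theorem isCoeff_const (v : Fin 2 → ℂ) : IsCoeff d Λ E 0 fun _ => v := fun x y => by
  have : source d Λ E 0 = fun _ => 0 := by
    ext1 s
    rw [source, show (![0, -(0 : ℝ → ℂ) s] : Fin 2 → ℂ) = 0 by ext i; fin_cases i <;> simp,
      smul_zero]
  simp [this]

/-- Within a cell, the solution `Φ c` is given by Duhamel's formula from the centre of the cell. -/
theorem IsCoeff.eq_duhamel (hc : IsCoeff d Λ E f c) (hd : 0 < d) (hf : LocallyIntegrable f)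
    {n : ℤ} {x : ℝ} (hx : x ∈ cell d n) :
    fundamental d Λ E x • c x = duhamel E (n * d) f (monodromy d Λ E ^ n • c (n * d)) x := by
  set P := monodromy d Λ E
  set g : ℝ → Fin 2 → ℂ :=
    fun s => ![freeSin E (s - n * d) * f s, -(freeCos E (s - n * d) * f s)]
  have hsub : Set.uIcc (n * d) x ⊆ cell d n := by
    have hn : (n * d : ℝ) ∈ cell d n := ⟨by linarith, by linarith⟩
    exact Set.ordConnected_Ioo.uIcc_subset hn hx
  have hg : IntervalIntegrable g volume (n * d) x :=
    (integrable_duhamel_source E hf (n * d) isCompact_uIcc).intervalIntegrable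
  have h1 : P ^ n • c x = P ^ n • c (n * d) + ∫ s in (n * d : ℝ)..x, g s := by
    have h2 : c x = c (n * d) + ∫ s in (n * d : ℝ)..x, source d Λ E f s := by
      rw [← hc]; abel
    rw [h2, smul_add, ← actionCLM_apply _ (∫ s in (n * d : ℝ)..x, source d Λ E f s),
      ← ContinuousLinearMap.intervalIntegral_comp_comm _
        ((locallyIntegrable_source Λ E hd hf).intervalIntegrable _ _)]
    congr 1
    exact intervalIntegral.integral_congr fun s hs => source_of_mem_cell Λ E hd (hsub hs) f
  have h3 : ∀ i, (∫ s in (n * d : ℝ)..x, g s) i = ∫ s in (n * d : ℝ)..x, g s i := fun i =>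
    ((ContinuousLinearMap.proj (R := ℂ) (φ := fun _ : Fin 2 => ℂ) i).intervalIntegral_comp_comm
      hg).symm
  rw [fundamental_of_mem_cell Λ E hd hx, mul_smul, h1, propagator_smul, duhamel]
  simp only [Pi.add_apply, h3]
  rfl

theorem IsCoeff.hasDerivAt (hc : IsCoeff d Λ E f c) (hd : 0 < d) (hf : LocallyIntegrable f)
    {x : ℝ} (hx : x ∈ freeRegion d) :
    HasDerivAt (fun x => (fundamental d Λ E x • c x) 0) ((fundamental d Λ E x • c x) 1) x := by
  have hx' := (mem_freeRegion_iff hd).1 hx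
  rw [hc.eq_duhamel hd hf hx']
  refine (hasDerivAt_duhamel E _ hf _ x).congr_of_eventuallyEq ?_
  filter_upwards [(isOpen_cell d _).mem_nhds hx'] with y hy
  rw [hc.eq_duhamel hd hf hy]

theorem IsCoeff.jet_eq (hc : IsCoeff d Λ E f c) (hd : 0 < d) (hf : LocallyIntegrable f)
    {x : ℝ} (hx : x ∈ freeRegion d) :
    jet (fun x => (fundamental d Λ E x • c x) 0) x = fundamental d Λ E x • c x := by
  ext i
  fin_cases i
  · rfl
  · exact (hc.hasDerivAt hd hf hx).deriv

theorem IsCoeff.deriv_ac (hc : IsCoeff d Λ E f c) (hd : 0 < d) (hf : LocallyIntegrable f)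
    {a b : ℝ} (hab : Set.uIcc a b ⊆ freeRegion d) :
    AbsolutelyContinuousOnInterval (deriv fun x => (fundamental d Λ E x • c x) 0) a b := by
  obtain ⟨n, hn⟩ := exists_uIcc_subset_cell hd hab
  refine (duhamel_ac E (n * d) hf (monodromy d Λ E ^ n • c (n * d)) 1 a b).congr_eqOn fun x hx => ?_
  rw [(hc.hasDerivAt hd hf (hab hx)).deriv, hc.eq_duhamel hd hf (hn hx)]

theorem IsCoeff.ae_hasDerivAt_deriv (hc : IsCoeff d Λ E f c) (hd : 0 < d)
    (hf : LocallyIntegrable f) :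
    ∀ᵐ x, HasDerivAt (deriv fun x => (fundamental d Λ E x • c x) 0)
      (-(f x + E * (fundamental d Λ E x • c x) 0)) x := by
  have h : ∀ᵐ x, ∀ n : ℤ, _ := ae_all_iff.2 fun n : ℤ =>
    duhamel_ae_hasDerivAt E (n * d) hf (monodromy d Λ E ^ n • c (n * d))
  filter_upwards [h, ae_mem_freeRegion d] with x hx hfree
  have hx' := (mem_freeRegion_iff hd).1 hfree
  rw [hc.eq_duhamel hd hf hx']
  refine (hx (cellIndex d x)).2.congr_of_eventuallyEq ?_
  filter_upwards [(isOpen_cell d _).mem_nhds hx'] with y hy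
  rw [(hc.hasDerivAt hd hf (cell_subset_freeRegion hd _ hy)).deriv, hc.eq_duhamel hd hf hy]

/-- The matching condition `Φ(x_n+) = Λ Φ(x_n-)` of the fundamental matrix. -/
theorem propagator_smul_zpow_succ (d : ℝ) (n : ℤ) :
    propagator E (-(d / 2)) * monodromy d Λ E ^ (n + 1) =
      Λ * (propagator E (d / 2) * monodromy d Λ E ^ n) := by
  rw [add_comm, zpow_add, zpow_one, propagator_neg, inv_mul_eq_iff_eq_mul]
  simp only [monodromy, mul_assoc]

theorem tendsto_propagator_smul {l : Filter ℝ} {x a : ℝ} {e : ℝ → Fin 2 → ℂ} {v : Fin 2 → ℂ}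
    (hl : l ≤ 𝓝 x) (he : Tendsto e l (𝓝 v)) :
    Tendsto (fun y => propagator E (y - a) • e y) l (𝓝 (propagator E (x - a) • v)) := by
  have h1 : Tendsto (fun y => (y - a, e y)) l (𝓝 (x - a, v)) :=
    (((continuous_id.sub continuous_const).tendsto x).mono_left hl).prodMk_nhds he
  have h2 := (continuous_propagator_smul E).tendsto (x - a, v)
  have h3 := h2.comp h1
  simp only [Function.comp_def] at h3
  exact h3

theorem IsCoeff.matchesAt (hc : IsCoeff d Λ E f c) (hd : 0 < d) (hf : LocallyIntegrable f)
    (n : ℤ) : MatchesAt Λ.1 (fun x => (fundamental d Λ E x • c x) 0) (site d n) := by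
  set P := monodromy d Λ E with hP
  have hcont := hc.continuous hd hf
  have ht : ∀ (m : ℤ) (l : Filter ℝ), l ≤ 𝓝 (site d n) →
      Tendsto (fun x => P ^ m • c x) l (𝓝 (P ^ m • c (site d n))) := fun m l hl =>
    (((actionCLM (P ^ m)).continuous.comp hcont).tendsto (site d n)).mono_left hl
  refine ⟨propagator E (d / 2) • P ^ n • c (site d n),
    propagator E (-(d / 2)) • P ^ (n + 1) • c (site d n), ?_, ?_, ?_⟩
  · have h := tendsto_propagator_smul (E := E) (a := n * d) nhdsWithin_le_nhds
      (ht n _ (nhdsWithin_le_nhds (s := Set.Iio (site d n))))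
    rw [show site d n - n * d = d / 2 by rw [site]; ring] at h
    refine h.congr' ?_
    filter_upwards [nhdsLT_site_mem_cell hd n] with x hx
    rw [hc.jet_eq hd hf (cell_subset_freeRegion hd _ hx), fundamental_of_mem_cell Λ E hd hx,
      mul_smul]
  · have h := tendsto_propagator_smul (E := E) (a := ((n + 1 : ℤ) : ℝ) * d) nhdsWithin_le_nhds
      (ht (n + 1) _ (nhdsWithin_le_nhds (s := Set.Ioi (site d n))))
    rw [show site d n - ((n + 1 : ℤ) : ℝ) * d = -(d / 2) by rw [site]; push_cast; ring] at h
    refine h.congr' ?_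
    filter_upwards [nhdsGT_site_mem_cell hd n] with x hx
    rw [hc.jet_eq hd hf (cell_subset_freeRegion hd _ hx), fundamental_of_mem_cell Λ E hd hx,
      mul_smul]
  · rw [← mul_smul, ← mul_smul, propagator_smul_zpow_succ, mul_smul]
    rfl

/-- A square integrable solution of the inhomogeneous equation belongs to the graph. -/
theorem IsCoeff.inGraph (hc : IsCoeff d Λ E f c) (hd : 0 < d) (hf : MemLp f 2 volume)
    (h0 : MemLp (fun x => (fundamental d Λ E x • c x) 0) 2 volume)
    (h1 : MemLp (fun x => (fundamental d Λ E x • c x) 1) 2 volume) :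
    InGraph d Λ.1 (h0.toLp _) (hf.toLp _ + (E : ℂ) • h0.toLp _) := by
  have hfl : LocallyIntegrable f := hf.locallyIntegrable (by norm_num)
  have hg : (fun x => -((hf.toLp _ + (E : ℂ) • h0.toLp _ : L2) x)) =ᵐ[volume]
      fun x => -(f x + E * (fundamental d Λ E x • c x) 0) := by
    filter_upwards [Lp.coeFn_add (hf.toLp _) ((E : ℂ) • h0.toLp _ : L2), hf.coeFn_toLp,
      Lp.coeFn_smul (E : ℂ) (h0.toLp _), h0.coeFn_toLp] with x e1 e2 e3 e4
    rw [e1, Pi.add_apply, e2, e3, Pi.smul_apply, e4, smul_eq_mul]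
  have hd1 : deriv (fun x => (fundamental d Λ E x • c x) 0) =ᵐ[volume]
      fun x => (fundamental d Λ E x • c x) 1 := by
    filter_upwards [ae_mem_freeRegion d] with x hx using (hc.hasDerivAt hd hfl hx).deriv
  refine ⟨_, h0.coeFn_toLp, ⟨fun x hx => (hc.hasDerivAt hd hfl hx).differentiableAt,
    fun a b hab => hc.deriv_ac hd hfl hab, ?_, ?_, ?_, ?_⟩, hc.matchesAt hd hfl⟩
  · rw [restrict_freeRegion]
    filter_upwards [hc.ae_hasDerivAt_deriv hd hfl, hg] with x hx e
    rw [e]; exact hx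
  · rwa [restrict_freeRegion]
  · rw [restrict_freeRegion]; exact (memLp_congr_ae hd1).2 h1
  · rw [restrict_freeRegion]
    exact (memLp_congr_ae hg).2 (hf.add (h0.const_mul (E : ℂ))).neg

theorem IsCoeff.aestronglyMeasurable (hc : IsCoeff d Λ E f c) (hd : 0 < d)
    (hf : LocallyIntegrable f) (i : Fin 2) :
    AEStronglyMeasurable (fun x => (fundamental d Λ E x • c x) i) volume := by
  have h : ∀ n : ℤ, ContinuousOn (fun x => (fundamental d Λ E x • c x) i) (cell d n) := by
    intro n
    have hac : Continuous fun x =>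
        duhamel E (n * d) f (monodromy d Λ E ^ n • c (n * d)) x i := by
      rw [continuous_iff_continuousAt]
      intro y
      refine (duhamel_ac E _ hf _ i (y - 1) (y + 1)).continuousOn.continuousAt ?_
      rw [Set.uIcc_of_le (by linarith)]
      exact Icc_mem_nhds (by linarith) (by linarith)
    refine hac.continuousOn.congr fun x hx => ?_
    rw [hc.eq_duhamel hd hf hx]
  rw [← restrict_freeRegion d]
  refine ContinuousOn.aestronglyMeasurable (fun x hx => ?_) (isOpen_freeRegion d).measurableSet
  have hx' := (mem_freeRegion_iff hd).1 hx
  exact ((h _).continuousAt ((isOpen_cell d _).mem_nhds hx')).continuousWithinAt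

/-! ### The discrete Laplacian of a solution -/

/-- `f(x + d) + f(x - d) - D f(x)`. For `D` the discriminant this annihilates the solutions of the
homogeneous equation. -/
def shiftSum {F : Type*} [AddCommGroup F] [Module ℂ F] (d : ℝ) (D : ℂ) (f : ℝ → F) (x : ℝ) : F :=
  f (x + d) + f (x - d) - D • f x

/-- The coefficient vector of `shiftSum d D u`, where `u` has the coefficient vector `c`. -/
noncomputable def shiftCoeff (d : ℝ) (Λ : SL2C) (E : ℝ) (c : ℝ → Fin 2 → ℂ) (x : ℝ) : Fin 2 → ℂ :=
  monodromy d Λ E • (c (x + d) - c x) + (monodromy d Λ E)⁻¹ • (c (x - d) - c x)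

/-- The term `D c(x)` is split as `P c(x) + P⁻¹ c(x)`, so only increments of `c` over one period
remain. -/
theorem fundamental_smul_shiftCoeff (hd : 0 < d) (c : ℝ → Fin 2 → ℂ) (x : ℝ) :
    fundamental d Λ E x • shiftCoeff d Λ E c x =
      fundamental d Λ E (x + d) • (c (x + d) - c x) +
        fundamental d Λ E (x - d) • (c (x - d) - c x) := by
  rw [shiftCoeff, smul_add, fundamental_add Λ E hd, fundamental_sub Λ E hd, mul_smul, mul_smul]

theorem source_add (hd : 0 < d) (f : ℝ → ℂ) (s : ℝ) :
    monodromy d Λ E • source d Λ E f (s + d) = source d Λ E (fun s => f (s + d)) s := by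
  rw [source, source, fundamental_add Λ E hd, mul_inv_rev, mul_smul, smul_inv_smul]

theorem source_sub (hd : 0 < d) (f : ℝ → ℂ) (s : ℝ) :
    (monodromy d Λ E)⁻¹ • source d Λ E f (s - d) = source d Λ E (fun s => f (s - d)) s := by
  rw [source, source, fundamental_sub Λ E hd, mul_inv_rev, inv_inv, mul_smul, inv_smul_smul]

theorem source_shiftSum (D : ℂ) (f : ℝ → ℂ) (s : ℝ) :
    source d Λ E (shiftSum d D f) s = source d Λ E (fun s => f (s + d)) s +
      source d Λ E (fun s => f (s - d)) s - D • source d Λ E f s := by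
  rw [source, source, source, source, ← smul_comm _ D, ← smul_add, ← smul_sub]
  congr 1
  ext i
  fin_cases i <;> simp [shiftSum]
  ring

/-- Since `Φ(x + d) = Φ(x) P`, translates of solutions are solutions, and so is their combination
`shiftSum`. -/
theorem IsCoeff.shift (hc : IsCoeff d Λ E f c) (hd : 0 < d) (hf : LocallyIntegrable f) :
    IsCoeff d Λ E (shiftSum d (monodromy d Λ E).1.trace f) (shiftCoeff d Λ E c) := by
  intro x y
  set P : SL2C := monodromy d Λ E
  have hs := (locallyIntegrable_source Λ E hd hf).intervalIntegrable
  have i1 : ∀ t, IntervalIntegrable (fun s => source d Λ E f (s + t)) volume x y := fun t => by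
    simpa using (hs (x + t) (y + t)).comp_add_right t
  have i2 : IntervalIntegrable (fun s => source d Λ E (fun s => f (s + d)) s) volume x y := by
    simp only [← source_add hd]
    exact ⟨(actionCLM P).integrable_comp (i1 d).1, (actionCLM P).integrable_comp (i1 d).2⟩
  have i3 : IntervalIntegrable (fun s => source d Λ E (fun s => f (s - d)) s) volume x y := by
    simp only [← source_sub hd]
    exact ⟨(actionCLM P⁻¹).integrable_comp (i1 (-d)).1,
      (actionCLM P⁻¹).integrable_comp (i1 (-d)).2⟩
  have e1 : ∫ s in x..y, source d Λ E (fun s => f (s + d)) s = P • (c (y + d) - c (x + d)) := by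
    simp only [← source_add hd]
    rw [hc (x + d) (y + d), ← intervalIntegral.integral_comp_add_right]
    exact (actionCLM P).intervalIntegral_comp_comm (i1 d)
  have e2 : ∫ s in x..y, source d Λ E (fun s => f (s - d)) s = P⁻¹ • (c (y - d) - c (x - d)) := by
    simp only [← source_sub hd]
    rw [hc (x - d) (y - d), ← intervalIntegral.integral_comp_sub_right]
    exact (actionCLM P⁻¹).intervalIntegral_comp_comm (i1 (-d))
  simp only [source_shiftSum]
  have i4 : IntervalIntegrable (fun s => P.1.trace • source d Λ E f s) volume x y :=
    (hs x y).smul P.1.trace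
  rw [intervalIntegral.integral_sub (i2.add i3) i4, intervalIntegral.integral_add i2 i3,
    intervalIntegral.integral_smul, e1, e2, ← hc x y, ← smul_add_inv_smul]
  simp only [shiftCoeff, smul_sub]
  abel

theorem norm_fundamental_smul_sub_le (hc : IsCoeff d Λ E f c) (hd : 0 < d)
    (hf : LocallyIntegrable f) {B : ℝ} (hB : ∀ x y, |x - y| ≤ d → ∀ v : Fin 2 → ℂ,
      ‖(fundamental d Λ E x * (fundamental d Λ E y)⁻¹) • v‖ ≤ B * ‖v‖)
    {x y : ℝ} (hxy : |y - x| ≤ d) :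
    ‖fundamental d Λ E y • (c y - c x)‖ ≤ |∫ s in x..y, B * ‖f s‖| := by
  have hs := (locallyIntegrable_source Λ E hd hf).intervalIntegrable x y
  rw [hc x y, ← actionCLM_apply, ← ContinuousLinearMap.intervalIntegral_comp_comm _ hs]
  refine intervalIntegral.norm_integral_le_abs_of_norm_le ?_
    ((hf.intervalIntegrable x y).norm.const_mul B)
  refine ae_restrict_of_forall_mem measurableSet_uIoc fun s hs => ?_
  have hs' : |y - s| ≤ d := by
    refine le_trans ?_ hxy
    exact Set.abs_sub_right_of_mem_uIcc (Set.uIoc_subset_uIcc hs)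
  have h := hB y s hs' ![0, -f s]
  rw [actionCLM_apply, source, ← mul_smul]
  refine h.trans (le_of_eq ?_)
  congr 1
  have e : ‖(![0, -f s] : Fin 2 → ℂ)‖ = max 0 ‖f s‖ := by
    simp [Pi.norm_def, Finset.univ_fin2]
  rw [e, max_eq_right (norm_nonneg _)]

/-- The discrete Laplacian of a solution is controlled locally by the inhomogeneity. -/
theorem IsCoeff.exists_shift_bound (hd : 0 < d) (Λ : SL2C) (E : ℝ) :
    ∃ B : ℝ, 0 ≤ B ∧ ∀ (f : ℝ → ℂ) (c : ℝ → Fin 2 → ℂ), IsCoeff d Λ E f c →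
      LocallyIntegrable f → ∀ x, ‖fundamental d Λ E x • shiftCoeff d Λ E c x‖ ≤
        B * ∫ s in (x - d)..(x + d), ‖f s‖ := by
  obtain ⟨B, hB0, hB⟩ := exists_fundamental_bound Λ E hd
  refine ⟨B, hB0, fun f c hc hf x => ?_⟩
  have hn : ∀ a b, IntervalIntegrable (fun s => ‖f s‖) volume a b := fun a b =>
    (hf.intervalIntegrable a b).norm
  rw [fundamental_smul_shiftCoeff hd]
  refine (norm_add_le _ _).trans ?_
  have h1 := norm_fundamental_smul_sub_le hc hd hf hB (x := x) (y := x + d)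
    (by simp [abs_of_pos hd])
  have h2 := norm_fundamental_smul_sub_le hc hd hf hB (x := x) (y := x - d)
    (by simp [abs_of_pos hd])
  rw [intervalIntegral.integral_const_mul, abs_of_nonneg (mul_nonneg hB0
    (intervalIntegral.integral_nonneg (by linarith) fun _ _ => norm_nonneg _))] at h1
  rw [intervalIntegral.integral_symm, abs_neg, intervalIntegral.integral_const_mul,
    abs_of_nonneg (mul_nonneg hB0
    (intervalIntegral.integral_nonneg (by linarith) fun _ _ => norm_nonneg _))] at h2
  rw [← intervalIntegral.integral_add_adjacent_intervals (hn (x - d) x) (hn x (x + d)), mul_add]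
  linarith

end source

/-! ### Bounds in `L²` -/

theorem lintegral_lintegral_Ioc {g : ℝ → ENNReal} (hg : AEMeasurable g) (d : ℝ) :
    ∫⁻ x, ∫⁻ s in Set.Ioc (x - d) (x + d), g s = ENNReal.ofReal (2 * d) * ∫⁻ s, g s := by
  have hA : MeasurableSet {p : ℝ × ℝ | p.1 - d < p.2 ∧ p.2 ≤ p.1 + d} :=
    (measurableSet_lt (measurable_fst.sub_const d) measurable_snd).inter
      (measurableSet_le measurable_snd (measurable_fst.add_const d))
  set A := {p : ℝ × ℝ | p.1 - d < p.2 ∧ p.2 ≤ p.1 + d}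
  have e1 : ∀ x, ∫⁻ s in Set.Ioc (x - d) (x + d), g s =
      ∫⁻ s, A.indicator (fun p => g p.2) (x, s) := fun x => by
    rw [← lintegral_indicator measurableSet_Ioc]
    rfl
  have e2 : ∀ s, ∫⁻ x, A.indicator (fun p => g p.2) (x, s) = ENNReal.ofReal (2 * d) * g s := by
    intro s
    have : ∀ x, A.indicator (fun p => g p.2) (x, s) =
        (Set.Ico (s - d) (s + d)).indicator (fun _ => g s) x := fun x => by
      have : (x, s) ∈ A ↔ x ∈ Set.Ico (s - d) (s + d) := by
        simp only [A, Set.mem_ofPred_eq, Set.mem_Ico]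
        constructor <;> rintro ⟨h1, h2⟩ <;> constructor <;> linarith
      by_cases h : (x, s) ∈ A
      · rw [Set.indicator_of_mem h, Set.indicator_of_mem (this.1 h)]
      · rw [Set.indicator_of_notMem h, Set.indicator_of_notMem (fun h' => h (this.2 h'))]
    simp only [this]
    rw [lintegral_indicator measurableSet_Ico, setLIntegral_const, Real.volume_Ico, mul_comm]
    congr 2; ring
  simp only [e1]
  rw [lintegral_lintegral_swap]
  · simp only [e2]
    rw [lintegral_const_mul'' _ hg]
  · exact (hg.comp_snd).indicator hA

theorem sq_setLIntegral_Ioc_le {g : ℝ → ENNReal} (hg : AEMeasurable g) {d : ℝ} (x : ℝ) :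
    (∫⁻ s in Set.Ioc (x - d) (x + d), g s) ^ 2 ≤
      ENNReal.ofReal (2 * d) * ∫⁻ s in Set.Ioc (x - d) (x + d), g s ^ 2 := by
  have h := ENNReal.lintegral_mul_le_Lp_mul_Lq (volume.restrict (Set.Ioc (x - d) (x + d)))
    Real.HolderConjugate.two_two hg.restrict (aemeasurable_const (b := (1 : ENNReal)))
  simp only [Pi.mul_apply, mul_one, lintegral_const, Measure.restrict_apply, one_pow,
    MeasurableSet.univ, Set.univ_inter, Real.volume_Ioc, ENNReal.rpow_two, one_mul] at h
  calc _ ≤ ((∫⁻ s in Set.Ioc (x - d) (x + d), g s ^ 2) ^ (1 / 2 : ℝ) *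
        ENNReal.ofReal (x + d - (x - d)) ^ (1 / 2 : ℝ)) ^ 2 := by gcongr
    _ = _ := by
      rw [mul_pow, ← ENNReal.rpow_two, ← ENNReal.rpow_two, ← ENNReal.rpow_mul, ← ENNReal.rpow_mul]
      rw [show (1 / 2 : ℝ) * 2 = 1 by norm_num, ENNReal.rpow_one, ENNReal.rpow_one, mul_comm,
        show x + d - (x - d) = 2 * d by ring]

theorem eLpNorm_two_eq {F : Type*} [NormedAddCommGroup F] (v : ℝ → F) :
    eLpNorm v 2 volume = (∫⁻ x, ‖v x‖ₑ ^ 2) ^ (1 / 2 : ℝ) := by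
  rw [eLpNorm_eq_lintegral_rpow_enorm_toReal (by norm_num) (by norm_num)]
  simp

/-- A function that is dominated by a moving average of `‖f‖` is in `L²` if `f` is. -/
theorem eLpNorm_le_of_le_average {F : Type*} [NormedAddCommGroup F] {f : ℝ → ℂ} {w : ℝ → F}
    {B d : ℝ} (hB : 0 ≤ B) (hd : 0 < d) (hf : MemLp f 2 volume)
    (hw : ∀ x, ‖w x‖ ≤ B * ∫ s in (x - d)..(x + d), ‖f s‖) :
    eLpNorm w 2 volume ≤ ENNReal.ofReal (B * (2 * d)) * eLpNorm f 2 volume := by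
  have hfl : LocallyIntegrable f := hf.locallyIntegrable (by norm_num)
  have hg : AEMeasurable fun s => ‖f s‖ₑ := hf.1.enorm
  have h1 : ∀ x, ‖w x‖ₑ ≤ ENNReal.ofReal B * ∫⁻ s in Set.Ioc (x - d) (x + d), ‖f s‖ₑ := by
    intro x
    rw [← ofReal_norm]
    refine (ENNReal.ofReal_le_ofReal (hw x)).trans (le_of_eq ?_)
    rw [ENNReal.ofReal_mul hB, intervalIntegral.integral_of_le (by linarith),
      ofReal_integral_norm_eq_lintegral_enorm
        ((intervalIntegrable_iff_integrableOn_Ioc_of_le (by linarith)).1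
          (hfl.intervalIntegrable _ _))]
  have h2 : ∫⁻ x, ‖w x‖ₑ ^ 2 ≤ ENNReal.ofReal (B * (2 * d)) ^ 2 * ∫⁻ s, ‖f s‖ₑ ^ 2 := by
    calc ∫⁻ x, ‖w x‖ₑ ^ 2
        ≤ ∫⁻ x, ENNReal.ofReal B ^ 2 * (ENNReal.ofReal (2 * d) *
          ∫⁻ s in Set.Ioc (x - d) (x + d), ‖f s‖ₑ ^ 2) := by
          refine lintegral_mono fun x => ?_
          calc _ ≤ (ENNReal.ofReal B * ∫⁻ s in Set.Ioc (x - d) (x + d), ‖f s‖ₑ) ^ 2 := by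
                gcongr; exact h1 x
            _ ≤ _ := by
              rw [mul_pow]
              gcongr
              exact sq_setLIntegral_Ioc_le hg x
      _ = _ := by
        rw [lintegral_const_mul' _ _ (by finiteness), lintegral_const_mul' _ _ (by finiteness),
          lintegral_lintegral_Ioc (hg.pow_const 2), ENNReal.ofReal_mul hB]
        ring
  rw [eLpNorm_two_eq, eLpNorm_two_eq]
  refine (ENNReal.rpow_le_rpow h2 (by norm_num)).trans (le_of_eq ?_)
  rw [ENNReal.mul_rpow_of_nonneg _ _ (by norm_num), ← ENNReal.rpow_two, ← ENNReal.rpow_mul]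
  norm_num

/-! ### The translation operators -/

/-- Translation `f ↦ f(· + a)` on `L²(ℝ)`. -/
noncomputable def translation (a : ℝ) : L2 →L[ℂ] L2 :=
  (Lp.compMeasurePreservingₗᵢ ℂ (fun x : ℝ => x + a)
    (measurePreserving_add_right volume a)).toContinuousLinearMap

theorem coeFn_translation (a : ℝ) (f : L2) :
    translation a f =ᵐ[volume] fun x => f (x + a) :=
  Lp.coeFn_compMeasurePreserving f (measurePreserving_add_right volume a)

theorem norm_translation_apply (a : ℝ) (f : L2) : ‖translation a f‖ = ‖f‖ :=
  (Lp.compMeasurePreservingₗᵢ ℂ (fun x : ℝ => x + a)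
    (measurePreserving_add_right volume a)).norm_map f

theorem norm_translation_add_translation_le (d : ℝ) :
    ‖translation d + translation (-d)‖ ≤ 2 := by
  refine ContinuousLinearMap.opNorm_le_bound _ (by norm_num) fun f => ?_
  change ‖translation d f + translation (-d) f‖ ≤ _
  refine (norm_add_le _ _).trans (le_of_eq ?_)
  rw [norm_translation_apply, norm_translation_apply]; ring

/-- The sum of two opposite translations has norm at most `2`, so its spectrum is in the disc of
radius `2`. -/
theorem exists_inverse_shift (d : ℝ) {D : ℂ} (hD : 2 < ‖D‖) :
    ∃ A : L2 →L[ℂ] L2, ∀ f, translation d (A f) + translation (-d) (A f) - D • A f = f := by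
  have h : D ∈ resolventSet ℂ (translation d + translation (-d)) := by
    refine spectrum.mem_resolventSet_of_norm_lt_mul ?_
    have h1 : ‖(1 : L2 →L[ℂ] L2)‖ ≤ 1 := ContinuousLinearMap.norm_id_le
    have h2 := norm_translation_add_translation_le d
    have h3 := norm_nonneg (translation d + translation (-d))
    nlinarith
  obtain ⟨A, hA⟩ := h
  refine ⟨-(↑A⁻¹ : L2 →L[ℂ] L2), fun f => ?_⟩
  have h1 : (A : L2 →L[ℂ] L2) ((↑A⁻¹ : L2 →L[ℂ] L2) f) = f := by
    rw [← mul_apply_eq_comp, A.mul_inv]; rfl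
  rw [hA] at h1
  have h2 : ∀ y : L2, (algebraMap ℂ (L2 →L[ℂ] L2) D - (translation d + translation (-d))) y =
      D • y - (translation d y + translation (-d) y) := fun y => rfl
  rw [h2] at h1
  simp only [neg_apply, map_neg, smul_neg]
  linear_combination (norm := module) h1

theorem eq_zero_of_translation_add_translation {d : ℝ} {D : ℂ} (hD : 2 < ‖D‖) {f : L2}
    (h : translation d f + translation (-d) f = D • f) : f = 0 := by
  have h1 : ‖D‖ * ‖f‖ ≤ 2 * ‖f‖ := by
    rw [← norm_smul, ← h]
    refine (norm_add_le _ _).trans (le_of_eq ?_)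
    rw [norm_translation_apply, norm_translation_apply]; ring
  by_contra hf
  have := norm_pos_iff.2 hf
  nlinarith

/-! ### A criterion for regular points -/

/-- A bijection onto the space with a bounded inverse; linearity of the inverse is automatic. -/
theorem isRegularPoint_of_bound {H : Type*} [NormedAddCommGroup H] [NormedSpace ℂ H]
    {T : H →ₗ.[ℂ] H} {z : ℂ} {C : ℝ}
    (hsurj : ∀ f, ∃ u : T.domain, T u - z • (u : H) = f ∧ ‖(u : H)‖ ≤ C * ‖f‖)
    (hinj : ∀ u : T.domain, T u - z • (u : H) = 0 → u = 0) : IsRegularPoint T z := by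
  set L : T.domain →ₗ[ℂ] H := T.toFun - z • T.domain.subtype with hL
  have hLa : ∀ u, L u = T u - z • (u : H) := fun u => rfl
  have hLinj : Function.Injective L := (injective_iff_map_eq_zero L).2 fun u hu => hinj u hu
  have hLsurj : Function.Surjective L := fun f => ⟨(hsurj f).choose, (hsurj f).choose_spec.1⟩
  set e := LinearEquiv.ofBijective L ⟨hLinj, hLsurj⟩
  have he : ∀ u, e u = T u - z • (u : H) := fun u => rfl
  refine ⟨(T.domain.subtype.comp e.symm.toLinearMap).mkContinuous C fun f => ?_, fun f => ?_,
    fun u => ?_⟩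
  · obtain ⟨u, hu, hb⟩ := hsurj f
    have : e.symm f = u := by rw [LinearEquiv.symm_apply_eq, he, hu]
    simpa [this] using hb
  · refine ⟨(e.symm f).2, ?_⟩
    have := he (e.symm f)
    rw [e.apply_symm_apply] at this
    exact this.symm
  · rw [← he u]
    simp

/-! ### Homogeneous solutions -/

section homogeneous

variable {d : ℝ} {Λ : SL2C} {E : ℝ} {u : ℝ → ℂ}

/-- In a cell, `T(-(x - nd)) (u, u')` has derivative zero, where `T` is the propagator. -/
theorem exists_jet_eq_propagator_smul (hd : 0 < d)
    (hu : ∀ x ∈ freeRegion d, DifferentiableAt ℝ u x)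
    (heq : ∀ x ∈ freeRegion d, HasDerivAt (deriv u) (-((E : ℂ) * u x)) x) (n : ℤ) :
    ∃ v, ∀ x ∈ cell d n, jet u x = propagator E (x - n * d) • v := by
  set w : ℝ → Fin 2 → ℂ := fun x => propagator E (-(x - n * d)) • jet u x with hw
  have hw' : ∀ x, w x = ![freeCos E (x - n * d) * u x - freeSin E (x - n * d) * deriv u x,
      E * freeSin E (x - n * d) * u x + freeCos E (x - n * d) * deriv u x] := fun x => by
    rw [hw]
    simp only [propagator_smul, freeCos_neg, freeSin_neg, jet]
    ext i
    fin_cases i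
    · simp; ring
    · simp
  have hder : ∀ x ∈ cell d n, HasDerivAt w 0 x := by
    intro x hx
    have hx' := cell_subset_freeRegion hd n hx
    have h1 := (hu x hx').hasDerivAt
    have h2 := heq x hx'
    have hC := hasDerivAt_freeCos_ofReal E (n * d) x
    have hS := hasDerivAt_freeSin_ofReal E (n * d) x
    rw [funext hw']
    refine hasDerivAt_pi.2 fun i => ?_
    fin_cases i
    · convert! (hC.mul h1).sub (hS.mul h2) using 1
      simp; ring
    · convert! ((hS.const_mul (E : ℂ)).mul h1).add (hC.mul h2) using 1
      simp; ring
  have hn : (n * d : ℝ) ∈ cell d n := ⟨by linarith, by linarith⟩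
  refine ⟨w (n * d), fun x hx => ?_⟩
  have hconst := (isOpen_cell d n).is_const_of_deriv_eq_zero isPreconnected_Ioo
    (fun y hy => (hder y hy).differentiableAt.differentiableWithinAt)
    (fun y hy => (hder y hy).deriv) hn hx
  rw [hconst]
  simp only [hw, propagator_neg, smul_inv_smul]

/-- A solution of the homogeneous equation is the fundamental matrix applied to a constant
vector. -/
theorem exists_jet_eq_fundamental_smul (hd : 0 < d)
    (hu : ∀ x ∈ freeRegion d, DifferentiableAt ℝ u x)
    (heq : ∀ x ∈ freeRegion d, HasDerivAt (deriv u) (-((E : ℂ) * u x)) x)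
    (hmatch : ∀ n : ℤ, MatchesAt Λ.1 u (site d n)) :
    ∃ v, ∀ x ∈ freeRegion d, jet u x = fundamental d Λ E x • v := by
  choose v hv using exists_jet_eq_propagator_smul hd hu heq
  have hstep : ∀ n, v (n + 1) = monodromy d Λ E • v n := by
    intro n
    obtain ⟨Um, Up, h1, h2, h3⟩ := hmatch n
    have t1 := tendsto_propagator_smul (E := E) (a := n * d) nhdsWithin_le_nhds
      (tendsto_const_nhds (x := v n) (f := 𝓝[<] (site d n)))
    have t2 := tendsto_propagator_smul (E := E) (a := ((n + 1 : ℤ) : ℝ) * d) nhdsWithin_le_nhds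
      (tendsto_const_nhds (x := v (n + 1)) (f := 𝓝[>] (site d n)))
    have e1 := tendsto_nhds_unique (h1.congr' (by
      filter_upwards [nhdsLT_site_mem_cell hd n] with x hx using hv n x hx)) t1
    have e2 := tendsto_nhds_unique (h2.congr' (by
      filter_upwards [nhdsGT_site_mem_cell hd n] with x hx using hv (n + 1) x hx)) t2
    rw [show site d n - n * d = d / 2 by rw [site]; ring] at e1
    rw [show site d n - ((n + 1 : ℤ) : ℝ) * d = -(d / 2) by rw [site]; push_cast; ring,
      propagator_neg, eq_inv_smul_iff] at e2
    rw [← e2, h3, e1, monodromy, mul_smul, mul_smul]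
    rfl
  have hall : ∀ n : ℤ, v n = monodromy d Λ E ^ n • v 0 := by
    intro n
    induction n using Int.induction_on with
    | zero => simp
    | succ i ih => rw [hstep, ih, add_comm, zpow_add, zpow_one, mul_smul]
    | pred i ih =>
      have h := hstep (-i - 1)
      rw [sub_add_cancel, ih, ← inv_smul_eq_iff] at h
      rw [← h, zpow_sub_one, ← mul_smul]
      congr 1
      rw [← zpow_neg_one, ← zpow_add, ← zpow_add, add_comm]
  refine ⟨v 0, fun x hx => ?_⟩
  have hx' := (mem_freeRegion_iff hd).1 hx
  rw [hv _ x hx', hall, fundamental, mul_smul]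

theorem fundamental_smul_add_sub (hd : 0 < d) (v : Fin 2 → ℂ) (x : ℝ) :
    fundamental d Λ E (x + d) • v + fundamental d Λ E (x - d) • v =
      (monodromy d Λ E).1.trace • fundamental d Λ E x • v := by
  rw [fundamental_add Λ E hd, fundamental_sub Λ E hd, mul_smul, mul_smul, ← smul_add,
    smul_add_inv_smul]
  exact smul_comm _ _ _

/-- Solutions of the homogeneous equation satisfy `u(x + d) + u(x - d) = D u(x)`. -/
theorem add_sub_eq_discriminant_mul (hd : 0 < d)
    (hu : ∀ x ∈ freeRegion d, DifferentiableAt ℝ u x)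
    (heq : ∀ x ∈ freeRegion d, HasDerivAt (deriv u) (-((E : ℂ) * u x)) x)
    (hmatch : ∀ n : ℤ, MatchesAt Λ.1 u (site d n)) {x : ℝ} (hx : x ∈ freeRegion d) :
    u (x + d) + u (x - d) = (monodromy d Λ E).1.trace * u x := by
  obtain ⟨v, hv⟩ := exists_jet_eq_fundamental_smul hd hu heq hmatch
  have h0 : ∀ y ∈ freeRegion d, u y = (fundamental d Λ E y • v) 0 := fun y hy =>
    congrFun (hv y hy) 0
  rw [h0 x hx, h0 _ ((add_mem_freeRegion_iff hd).2 hx), h0 _ ((sub_mem_freeRegion_iff hd).2 hx)]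
  exact congrFun (fundamental_smul_add_sub hd v x) 0

/-- Elements of the graph of `h_Λ - E` over zero are classical solutions. -/
theorem exists_classical_of_inGraph {f : L2} (h : InGraph d Λ.1 f ((E : ℂ) • f)) :
    ∃ u : ℝ → ℂ, f =ᵐ[volume] u ∧ (∀ x ∈ freeRegion d, DifferentiableAt ℝ u x) ∧
      (∀ x ∈ freeRegion d, HasDerivAt (deriv u) (-((E : ℂ) * u x)) x) ∧
      ∀ n : ℤ, MatchesAt Λ.1 u (site d n) := by
  obtain ⟨u, hfu, hu, hm⟩ := h
  refine ⟨u, hfu, hu.differentiableAt, fun x hx => ?_, hm⟩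
  have hO := isOpen_freeRegion d
  have hmem := hu.memLp
  rw [restrict_freeRegion] at hmem
  have hloc : LocallyIntegrable fun x => -((E : ℂ) * u x) :=
    ((hmem.const_mul (E : ℂ)).neg).locallyIntegrable (by norm_num)
  have hae := hu.hasDerivAt_deriv
  rw [restrict_freeRegion] at hae
  have hae' : ∀ᵐ x, HasDerivAt (deriv u) (-((E : ℂ) * u x)) x := by
    filter_upwards [hae, hfu, Lp.coeFn_smul (E : ℂ) f] with y h1 h2 h3
    rwa [h3, Pi.smul_apply, h2, smul_eq_mul] at h1
  obtain ⟨ε, hε, hball⟩ := Metric.isOpen_iff.1 hO x hx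
  have hsub : ∀ y ∈ Metric.ball x ε, Set.uIcc x y ⊆ freeRegion d := fun y hy =>
    ((convex_ball x ε).ordConnected.uIcc_subset (Metric.mem_ball_self hε) hy).trans hball
  -- `u'` is a primitive of the continuous function `-E u`, so it is differentiable everywhere
  have hint : ∀ y ∈ Metric.ball x ε,
      deriv u y = deriv u x + ∫ t in x..y, -((E : ℂ) * u t) := fun y hy => by
    rw [← (hu.deriv_ac x y (hsub y hy)).sub_eq_integral
      (by filter_upwards [hae'] with t ht _ using ht) hloc]
    ring
  have hcont : ContinuousAt (fun x => -((E : ℂ) * u x)) x :=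
    ((hu.differentiableAt x hx).continuousAt.const_mul _).neg
  have h1 := (intervalIntegral.integral_hasDerivAt_right (hloc.intervalIntegrable x x)
    (hloc.aestronglyMeasurable.stronglyMeasurableAtFilter) hcont).const_add (deriv u x)
  refine h1.congr_of_eventuallyEq ?_
  filter_upwards [Metric.ball_mem_nhds x hε] with y hy using hint y hy

end homogeneous

/-! ### Energies with `|D(E)| > 2` are regular -/

theorem isRegularPoint_of_two_lt {d : ℝ} (hd : 0 < d) (Λ : SL2C) (E : ℝ)
    (hD : 2 < ‖(monodromy d Λ E).1.trace‖) :
    IsRegularPoint (kronigPenney d hd Λ.1) (E : ℂ) := by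
  set D := (monodromy d Λ E).1.trace
  obtain ⟨A, hA⟩ := exists_inverse_shift d hD
  obtain ⟨B, hB0, hB⟩ := IsCoeff.exists_shift_bound hd Λ E
  refine isRegularPoint_of_bound (C := B * (2 * d) * ‖A‖) (fun f => ?_) fun u hu => ?_
  · -- `A f` is `g` with `g(x + d) + g(x - d) - D g(x) = f(x)`; the shifted solution for `g`
    -- solves for `f`
    have hg : MemLp (A f : ℝ → ℂ) 2 volume := Lp.memLp (A f)
    have hgl : LocallyIntegrable (A f : ℝ → ℂ) := hg.locallyIntegrable (by norm_num)
    have hc := isCoeff_integral (Λ := Λ) (E := E) hd hgl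
    have hc' := hc.shift hd hgl
    set c := shiftCoeff d Λ E fun x => ∫ s in (0 : ℝ)..x, source d Λ E (A f) s
    have hFae : shiftSum d D (A f : ℝ → ℂ) =ᵐ[volume] f := by
      have h1 := coeFn_translation d (A f)
      have h2 := coeFn_translation (-d) (A f)
      have h3 := Lp.coeFn_add (translation d (A f)) (translation (-d) (A f))
      have h4 := Lp.coeFn_sub (translation d (A f) + translation (-d) (A f)) (D • A f)
      have h5 := Lp.coeFn_smul D (A f)
      rw [hA f] at h4
      filter_upwards [h1, h2, h3, h4, h5] with x e1 e2 e3 e4 e5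
      rw [e4, Pi.sub_apply, e3, Pi.add_apply, e1, e2, e5]
      rfl
    have hF : MemLp (shiftSum d D (A f : ℝ → ℂ)) 2 volume :=
      (memLp_congr_ae hFae).2 (Lp.memLp f)
    have hFl : LocallyIntegrable (shiftSum d D (A f : ℝ → ℂ)) :=
      hF.locallyIntegrable (by norm_num)
    have hbound : ∀ i, eLpNorm (fun x => (fundamental d Λ E x • c x) i) 2 volume ≤
        ENNReal.ofReal (B * (2 * d)) * eLpNorm (A f : ℝ → ℂ) 2 volume := fun i =>
      eLpNorm_le_of_le_average hB0 hd hg fun x =>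
        (norm_le_pi_norm _ i).trans (hB _ _ hc hgl x)
    have hmem : ∀ i, MemLp (fun x => (fundamental d Λ E x • c x) i) 2 volume := fun i =>
      ⟨hc'.aestronglyMeasurable hd hFl i,
        (hbound i).trans_lt (ENNReal.mul_lt_top ENNReal.ofReal_lt_top hg.2)⟩
    have hgr := hc'.inGraph hd hF (hmem 0) (hmem 1)
    have hFf : hF.toLp _ = f := Lp.ext (hF.coeFn_toLp.trans hFae)
    rw [hFf, ← mem_graph_kronigPenney hd, LinearPMap.mem_graph_iff] at hgr
    obtain ⟨y, hy1, hy2⟩ := hgr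
    refine ⟨y, ?_, ?_⟩
    · rw [hy2, hy1]
      simp
    · rw [hy1]
      have h1 : ‖A f‖ ≤ ‖A‖ * ‖f‖ := A.le_opNorm f
      change ‖(hmem 0).toLp _‖ ≤ _
      calc ‖(hmem 0).toLp _‖ ≤ B * (2 * d) * ‖A f‖ := by
            rw [Lp.norm_toLp, Lp.norm_def]
            refine (ENNReal.toReal_mono (ENNReal.mul_lt_top ENNReal.ofReal_lt_top hg.2).ne
              (hbound 0)).trans (le_of_eq ?_)
            rw [ENNReal.toReal_mul, ENNReal.toReal_ofReal (by positivity)]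
        _ ≤ B * (2 * d) * (‖A‖ * ‖f‖) := by gcongr
        _ = _ := by ring
  · have h1 : InGraph d Λ.1 (u : L2) ((E : ℂ) • (u : L2)) := by
      rw [← mem_graph_kronigPenney hd, LinearPMap.mem_graph_iff]
      exact ⟨u, rfl, sub_eq_zero.1 hu⟩
    obtain ⟨w, hw, w1, w2, w3⟩ := exists_classical_of_inGraph h1
    have h2 : translation d (u : L2) + translation (-d) (u : L2) = D • (u : L2) := by
      apply Lp.ext
      have hqm : ∀ a : ℝ, Measure.QuasiMeasurePreserving (fun x : ℝ => x + a) volume volume :=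
        fun a => (measurePreserving_add_right volume a).quasiMeasurePreserving
      have ha := (hqm d).ae_eq_comp hw
      have hb := (hqm (-d)).ae_eq_comp hw
      filter_upwards [coeFn_translation d (u : L2), coeFn_translation (-d) (u : L2),
        Lp.coeFn_add (translation d (u : L2)) (translation (-d) (u : L2)),
        Lp.coeFn_smul D (u : L2), hw, ha, hb, ae_mem_freeRegion d] with x e1 e2 e3 e4 e5 e6 e7 e8
      simp only [Function.comp_apply] at e6 e7
      rw [e3, Pi.add_apply, e1, e2, e4, Pi.smul_apply, e5, e6, e7]
      exact add_sub_eq_discriminant_mul hd w1 w2 w3 e8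
    exact Subtype.ext (eq_zero_of_translation_add_translation hD h2)

/-! ### Bounded Bloch solutions -/

section bloch

variable {d : ℝ} {Λ : SL2C} {E : ℝ} {v : Fin 2 → ℂ} {s : ℂ}

theorem exists_eigenvector {P : SL2C} {s : ℂ} (hs : s ^ 2 = 1) (hP : P.1.trace = 2 * s) :
    ∃ v : Fin 2 → ℂ, v ≠ 0 ∧ P • v = s • v := by
  have hdet : P.1.det = 1 := P.2
  have h : (P.1 - Matrix.scalar (Fin 2) s).det = 0 := by
    rw [Matrix.det_fin_two] at hdet ⊢
    rw [Matrix.trace_fin_two] at hP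
    simp [Matrix.scalar_apply]
    linear_combination hdet - hs - s * hP
  obtain ⟨v, hv, h⟩ := Matrix.exists_mulVec_eq_zero_iff.2 h
  refine ⟨v, hv, ?_⟩
  rw [Matrix.sub_mulVec, sub_eq_zero] at h
  have h2 : (Matrix.scalar (Fin 2) s).mulVec v = s • v := by
    ext i
    simp [Matrix.scalar_apply, Matrix.mulVec_diagonal]
  rw [← h2, ← h]
  rfl

theorem hasDerivAt_fundamental_smul_zero (hd : 0 < d) (v : Fin 2 → ℂ) {x : ℝ}
    (hx : x ∈ freeRegion d) :
    HasDerivAt (fun x => (fundamental d Λ E x • v) 0) ((fundamental d Λ E x • v) 1) x :=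
  (isCoeff_const v).hasDerivAt hd locallyIntegrable_zero hx

theorem hasDerivAt_fundamental_smul_one (hd : 0 < d) (v : Fin 2 → ℂ) {x : ℝ}
    (hx : x ∈ freeRegion d) :
    HasDerivAt (fun x => (fundamental d Λ E x • v) 1)
      (-((E : ℂ) * (fundamental d Λ E x • v) 0)) x := by
  have hx' := (mem_freeRegion_iff hd).1 hx
  set n := cellIndex d x
  set k := monodromy d Λ E ^ n • v
  have e : ∀ y ∈ cell d n, fundamental d Λ E y • v = propagator E (y - n * d) • k := fun y hy => by
    rw [fundamental_of_mem_cell Λ E hd hy, mul_smul]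
  have h := ((hasDerivAt_freeSin_ofReal E (n * d) x).const_mul (E : ℂ)).fun_neg.mul_const (k 0)
    |>.add ((hasDerivAt_freeCos_ofReal E (n * d) x).mul_const (k 1))
  rw [e x hx', propagator_smul]
  have h' : HasDerivAt (fun y => (propagator E (y - n * d) • k) 1)
      (-((E : ℂ) * (freeCos E (x - n * d) * k 0 + freeSin E (x - n * d) * k 1))) x := by
    simp only [propagator_smul]
    convert! h using 1
    ring
  refine h'.congr_of_eventuallyEq ?_
  filter_upwards [(isOpen_cell d n).mem_nhds hx'] with y hy
  rw [e y hy]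

theorem fundamental_add_smul_eigenvector (hd : 0 < d) (hv : monodromy d Λ E • v = s • v) (x : ℝ) :
    fundamental d Λ E (x + d) • v = s • fundamental d Λ E x • v := by
  rw [fundamental_add Λ E hd, mul_smul, hv]
  exact smul_comm _ _ _

theorem exists_fundamental_smul_bound (hv : monodromy d Λ E • v = s • v) (hs : ‖s‖ = 1)
    (hd : 0 < d) : ∃ M : ℝ, 0 ≤ M ∧ ∀ x i, ‖(fundamental d Λ E x • v) i‖ ≤ M := by
  obtain ⟨B, hB0, hB⟩ := exists_propagator_bound E (d / 2)
  have hs0 : s ≠ 0 := by rintro rfl; simp at hs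
  have hpow : ∀ n : ℤ, monodromy d Λ E ^ n • v = s ^ n • v := by
    intro n
    induction n using Int.induction_on with
    | zero => simp
    | succ i ih =>
      rw [zpow_add_one, mul_smul, hv, smul_comm, ih, smul_smul, zpow_add_one₀ hs0, mul_comm]
    | pred i ih =>
      have hv' : (monodromy d Λ E)⁻¹ • v = s⁻¹ • v := by
        rw [inv_smul_eq_iff, smul_comm, hv, smul_smul, inv_mul_cancel₀ hs0, one_smul]
      rw [zpow_sub_one, mul_smul, hv', smul_comm, ih, smul_smul, zpow_sub_one₀ hs0, mul_comm]
  refine ⟨B * ‖v‖, by positivity, fun x i => (norm_le_pi_norm _ i).trans ?_⟩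
  have h := cellIndex_spec hd x
  rw [fundamental, mul_smul, hpow]
  refine (hB _ (abs_le.2 ⟨by linarith, by linarith⟩) _).trans (le_of_eq ?_)
  rw [norm_smul, norm_zpow, hs, one_zpow, one_mul]

theorem exists_isBlochSolution (hd : 0 < d) (hv : monodromy d Λ E • v = s • v) (hv0 : v ≠ 0)
    {θ : ℝ} (hθ : Complex.exp (θ * Complex.I) = s) :
    IsBlochSolution d Λ.1 E θ fun x => (fundamental d Λ E x • v) 0 where
  differentiableAt x hx := (hasDerivAt_fundamental_smul_zero hd v hx).differentiableAt
  equation x hx := by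
    refine (hasDerivAt_fundamental_smul_one hd v hx).congr_of_eventuallyEq ?_
    filter_upwards [(isOpen_freeRegion d).mem_nhds hx] with y hy
    exact (hasDerivAt_fundamental_smul_zero hd v hy).deriv
  matching := (isCoeff_const v).matchesAt hd locallyIntegrable_zero
  quasiperiodic x _ := by
    rw [hθ]
    exact congrFun (fundamental_add_smul_eigenvector hd hv x) 0
  nonzero := by
    by_contra! hcon
    have h0 : (0 : ℝ) ∈ freeRegion d := cell_subset_freeRegion hd 0 (by
      simp only [cell, Set.mem_Ioo]; push_cast; constructor <;> linarith)
    have h1 : (fundamental d Λ E 0 • v) 1 = 0 := by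
      refine (hasDerivAt_fundamental_smul_zero hd v h0).unique
        ((hasDerivAt_const (0 : ℝ) (0 : ℂ)).congr_of_eventuallyEq ?_)
      filter_upwards [(isOpen_freeRegion d).mem_nhds h0] with y hy using hcon y hy
    have h2 : fundamental d Λ E 0 • v = 0 := by
      ext i
      fin_cases i
      · exact hcon 0 h0
      · exact h1
    exact hv0 ((smul_eq_zero_iff_eq _).1 h2)

/-! ### Cutting off a Bloch solution -/

/-- The product of a homogeneous solution with a cutoff that is constant near the sites lies in
the domain of the operator. -/
theorem inGraph_cutoff (hd : 0 < d) {χ : ℝ → ℝ} (hχ : ContDiff ℝ 2 χ) (hsupp : HasCompactSupport χ)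
    (hsite : ∀ n, ∃ κ : ℝ, ∀ᶠ x in 𝓝 (site d n), χ x = κ) {M : ℝ}
    (hM : ∀ x i, ‖(fundamental d Λ E x • v) i‖ ≤ M) :
    ∃ (h0 : MemLp (fun x => χ x * (fundamental d Λ E x • v) 0) 2 volume)
      (h2 : MemLp (fun x => (deriv (deriv χ) x : ℝ) * (fundamental d Λ E x • v) 0 +
        2 * (deriv χ x : ℝ) * (fundamental d Λ E x • v) 1) 2 volume),
      InGraph d Λ.1 (h0.toLp _) ((E : ℂ) • h0.toLp _ - h2.toLp _) := by
  set u : ℝ → ℂ := fun x => (fundamental d Λ E x • v) 0 with hu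
  set u1 : ℝ → ℂ := fun x => (fundamental d Λ E x • v) 1 with hu1
  have du : ∀ x ∈ freeRegion d, HasDerivAt u (u1 x) x := fun x hx =>
    hasDerivAt_fundamental_smul_zero hd v hx
  have du1 : ∀ x ∈ freeRegion d, HasDerivAt u1 (-((E : ℂ) * u x)) x := fun x hx =>
    hasDerivAt_fundamental_smul_one hd v hx
  have mu : AEStronglyMeasurable u volume :=
    (isCoeff_const v).aestronglyMeasurable hd locallyIntegrable_zero 0
  have mu1 : AEStronglyMeasurable u1 volume :=
    (isCoeff_const v).aestronglyMeasurable hd locallyIntegrable_zero 1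
  have hχ1 : ContDiff ℝ 1 (deriv χ) := 
    ((contDiff_succ_iff_deriv (n := 1)).1 (by rw [one_add_one_eq_two]; exact hχ)).2.2
  have hc2 : Continuous (deriv (deriv χ)) := hχ1.continuous_deriv le_rfl
  have dχ : ∀ x, HasDerivAt (fun x => (χ x : ℂ)) ((deriv χ x : ℝ) : ℂ) x := fun x =>
    ((hχ.differentiable (by norm_num)) x).hasDerivAt.ofReal_comp
  have dχ1 : ∀ x, HasDerivAt (fun x => ((deriv χ x : ℝ) : ℂ)) ((deriv (deriv χ) x : ℝ) : ℂ) x :=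
    fun x =>
    ((hχ1.differentiable (by norm_num)) x).hasDerivAt.ofReal_comp
  have key : ∀ (ρ : ℝ → ℝ) (w : ℝ → ℂ), Continuous ρ → HasCompactSupport ρ →
      AEStronglyMeasurable w volume → (∀ x, ‖w x‖ ≤ M) →
      MemLp (fun x => ρ x * w x) 2 volume := by
    intro ρ w hρ hρs hw hwM
    refine (hρ.memLp_of_hasCompactSupport (p := 2) (μ := volume) hρs).of_le_mul (c := M)
      ((Complex.continuous_ofReal.comp hρ).aestronglyMeasurable.mul hw) (Eventually.of_forall
      fun x => ?_)
    rw [norm_mul, Complex.norm_real, mul_comm]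
    gcongr
    exact hwM x
  have h0 := key χ u hχ.continuous hsupp mu fun x => hM x 0
  have h1a := key (deriv χ) u hχ1.continuous hsupp.deriv mu fun x => hM x 0
  have h1b := key χ u1 hχ.continuous hsupp mu1 fun x => hM x 1
  have h2a := key (deriv (deriv χ)) u hc2 hsupp.deriv.deriv mu fun x => hM x 0
  have h2b := (key (deriv χ) u1 hχ1.continuous hsupp.deriv mu1 fun x => hM x 1).const_mul 2
  have h2 : MemLp (fun x => (deriv (deriv χ) x : ℝ) * u x + 2 * (deriv χ x : ℝ) * u1 x) 2
      volume := by
    refine (memLp_congr_ae (Eventually.of_forall fun x => ?_)).1 (h2a.add h2b)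
    simp only [Pi.add_apply, mul_assoc]
  have dw : ∀ x ∈ freeRegion d,
      HasDerivAt (fun x => χ x * u x) ((deriv χ x : ℝ) * u x + χ x * u1 x) x := fun x hx =>
    (dχ x).mul (du x hx)
  have dw1 : ∀ x ∈ freeRegion d, HasDerivAt (deriv fun x => χ x * u x)
      ((deriv (deriv χ) x : ℝ) * u x + 2 * (deriv χ x : ℝ) * u1 x - E * (χ x * u x)) x :=
      fun x hx => by
    have h := ((dχ1 x).mul (du x hx)).add ((dχ x).mul (du1 x hx))
    have h' := h.congr_of_eventuallyEq (f₁ := deriv fun x => χ x * u x) (by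
      filter_upwards [(isOpen_freeRegion d).mem_nhds hx] with y hy using (dw y hy).deriv)
    convert! h' using 1
    ring
  have hg : (fun x => -(((E : ℂ) • h0.toLp _ - h2.toLp _ : L2) x)) =ᵐ[volume]
      fun x => (deriv (deriv χ) x : ℝ) * u x + 2 * (deriv χ x : ℝ) * u1 x - E * (χ x * u x) := by
    filter_upwards [Lp.coeFn_sub ((E : ℂ) • h0.toLp _ : L2) (h2.toLp _), h2.coeFn_toLp,
      Lp.coeFn_smul (E : ℂ) (h0.toLp _), h0.coeFn_toLp] with x e1 e2 e3 e4
    rw [e1, Pi.sub_apply, e2, e3, Pi.smul_apply, e4, smul_eq_mul]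
    ring
  refine ⟨h0, h2, fun x => χ x * u x, h0.coeFn_toLp, ⟨fun x hx => (dw x hx).differentiableAt,
    fun a b hab => ?_, ?_, ?_, ?_, ?_⟩, fun n => ?_⟩
  · refine absolutelyContinuousOnInterval_of_hasDerivAt (fun x hx => dw1 x (hab hx)) fun x hx => ?_
    have c0 := (du x (hab hx)).continuousAt
    have c1 := (du1 x (hab hx)).continuousAt
    have k0 := (dχ x).continuousAt
    have k1 := (dχ1 x).continuousAt
    have k2 : ContinuousAt (fun x => ((deriv (deriv χ) x : ℝ) : ℂ)) x :=
      (Complex.continuous_ofReal.comp hc2).continuousAt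
    exact (((k2.mul c0).add ((continuousAt_const.mul k1).mul c1)).sub
      (continuousAt_const.mul (k0.mul c0))).continuousWithinAt
  · rw [restrict_freeRegion]
    filter_upwards [hg, ae_mem_freeRegion d] with x e hx
    rw [e]; exact dw1 x hx
  · rwa [restrict_freeRegion]
  · rw [restrict_freeRegion]
    refine (memLp_congr_ae ?_).2 (h1a.add h1b)
    filter_upwards [ae_mem_freeRegion d] with x hx using (dw x hx).deriv
  · rw [restrict_freeRegion]
    refine (memLp_congr_ae hg).2 (h2.sub (h0.const_mul (E : ℂ)))
  · obtain ⟨κ, hκ⟩ := hsite n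
    obtain ⟨Um, Up, t1, t2, t3⟩ := (isCoeff_const v).matchesAt (Λ := Λ) (E := E) hd
      locallyIntegrable_zero n
    have hev : ∀ᶠ x in 𝓝 (site d n), jet (fun x => χ x * u x) x = (κ : ℂ) • jet u x := by
      filter_upwards [hκ.eventually_nhds] with x hx
      have hx' : (fun x => χ x * u x) =ᶠ[𝓝 x] (κ : ℂ) • u := by
        filter_upwards [hx] with y hy
        rw [hy]; rfl
      ext i
      fin_cases i
      · exact hx'.eq_of_nhds
      · exact hx'.deriv_eq.trans (by rw [deriv_smul_fun]; rfl)
    refine ⟨(κ : ℂ) • Um, (κ : ℂ) • Up, ?_, ?_, by rw [t3, Matrix.mulVec_smul]⟩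
    · exact (t1.const_smul (κ : ℂ)).congr' ((hev.filter_mono nhdsWithin_le_nhds).mono
        fun x hx => hx.symm)
    · exact (t2.const_smul (κ : ℂ)).congr' ((hev.filter_mono nhdsWithin_le_nhds).mono
        fun x hx => hx.symm)

end bloch

/-! ### Weyl sequences -/

/-- A smooth step that rises from `0` to `1` between `0` and `d / 4`, away from the sites. -/
noncomputable def step (d x : ℝ) : ℝ := Real.smoothTransition (4 / d * x)

section step

variable {d : ℝ}

theorem contDiff_step (d : ℝ) : ContDiff ℝ 2 (step d) :=
  Real.smoothTransition.contDiff.comp (contDiff_const.mul contDiff_id)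

theorem step_of_nonpos (hd : 0 < d) {x : ℝ} (hx : x ≤ 0) : step d x = 0 :=
  Real.smoothTransition.zero_of_nonpos (mul_nonpos_of_nonneg_of_nonpos (by positivity) hx)

theorem step_of_ge (hd : 0 < d) {x : ℝ} (hx : d / 4 ≤ x) : step d x = 1 := by
  refine Real.smoothTransition.one_of_one_le ?_
  calc (1 : ℝ) = 4 / d * (d / 4) := by field_simp
    _ ≤ _ := by gcongr

theorem hasCompactSupport_deriv_step (hd : 0 < d) : HasCompactSupport (deriv (step d)) := by
  refine HasCompactSupport.intro (isCompact_Icc (a := 0) (b := d / 4)) fun x hx => ?_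
  simp only [Set.mem_Icc, not_and_or, not_le] at hx
  rcases hx with hx | hx
  · have h : step d =ᶠ[𝓝 x] fun _ => 0 := by
      filter_upwards [Iio_mem_nhds hx] with y hy using step_of_nonpos hd (le_of_lt hy)
    rw [h.deriv_eq, deriv_const]
  · have h : step d =ᶠ[𝓝 x] fun _ => 1 := by
      filter_upwards [Ioi_mem_nhds hx] with y hy using step_of_ge hd (le_of_lt hy)
    rw [h.deriv_eq, deriv_const]

theorem step_eventually_const (hd : 0 < d) (n : ℤ) :
    ∃ κ : ℝ, ∀ᶠ x in 𝓝 (site d n), step d x = κ := by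
  rcases le_or_gt 0 n with hn | hn
  · have hn' : (0 : ℝ) ≤ n := by exact_mod_cast hn
    refine ⟨1, ?_⟩
    filter_upwards [Ioi_mem_nhds (show d / 4 < site d n by rw [site]; nlinarith)] with y hy
    exact step_of_ge hd (le_of_lt hy)
  · have hn' : (n : ℝ) ≤ -1 := by exact_mod_cast Int.le_sub_one_of_lt hn
    refine ⟨0, ?_⟩
    filter_upwards [Iio_mem_nhds (show site d n < 0 by rw [site]; nlinarith)] with y hy
    exact step_of_nonpos hd (le_of_lt hy)

/-- A smooth cutoff that is `1` on `[d / 4, N d]` and vanishes outside `[0, N d + d / 4]`. -/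
noncomputable def cutoff (d : ℝ) (N : ℕ) (x : ℝ) : ℝ := step d x - step d (x - N * d)

theorem contDiff_cutoff (d : ℝ) (N : ℕ) : ContDiff ℝ 2 (cutoff d N) :=
  (contDiff_step d).sub ((contDiff_step d).comp (contDiff_id.sub contDiff_const))

theorem hasCompactSupport_cutoff (hd : 0 < d) (N : ℕ) : HasCompactSupport (cutoff d N) := by
  have hN : 0 ≤ N * d := by positivity
  refine HasCompactSupport.intro (isCompact_Icc (a := 0) (b := N * d + d / 4)) fun x hx => ?_
  simp only [Set.mem_Icc, not_and_or, not_le] at hx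
  rcases hx with hx | hx
  · rw [cutoff, step_of_nonpos hd hx.le, step_of_nonpos hd (by linarith), sub_zero]
  · rw [cutoff, step_of_ge hd (by linarith), step_of_ge hd (by linarith), sub_self]

theorem cutoff_eventually_const (hd : 0 < d) (N : ℕ) (n : ℤ) :
    ∃ κ : ℝ, ∀ᶠ x in 𝓝 (site d n), cutoff d N x = κ := by
  obtain ⟨κ₁, h₁⟩ := step_eventually_const hd n
  obtain ⟨κ₂, h₂⟩ := step_eventually_const hd (n - N)
  have ht : Tendsto (fun x : ℝ => x - N * d) (𝓝 (site d n)) (𝓝 (site d (n - N))) := by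
    rw [show site d (n - N) = site d n - N * d by simp only [site]; push_cast; ring]
    exact tendsto_id.sub_const _
  refine ⟨κ₁ - κ₂, ?_⟩
  filter_upwards [h₁, ht.eventually h₂] with x e₁ e₂
  rw [cutoff, e₁, e₂]

theorem cutoff_eq_one (hd : 0 < d) {N : ℕ} {x : ℝ} (h1 : d / 4 ≤ x) (h2 : x ≤ N * d) :
    cutoff d N x = 1 := by
  rw [cutoff, step_of_ge hd h1, step_of_nonpos hd (by linarith), sub_zero]

theorem deriv_cutoff (d : ℝ) (N : ℕ) :
    deriv (cutoff d N) = fun x => deriv (step d) x - deriv (step d) (x - N * d) := by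
  have hs : Differentiable ℝ (step d) := (contDiff_step d).differentiable (by norm_num)
  ext x
  exact ((hs x).hasDerivAt.sub ((hs _).hasDerivAt.comp_sub_const x (N * d))).deriv

theorem deriv_deriv_cutoff (d : ℝ) (N : ℕ) : deriv (deriv (cutoff d N)) =
    fun x => deriv (deriv (step d)) x - deriv (deriv (step d)) (x - N * d) := by
  have h1 : ContDiff ℝ 1 (deriv (step d)) :=
    ((contDiff_succ_iff_deriv (n := 1)).1 (by rw [one_add_one_eq_two]; exact contDiff_step d)).2.2
  have hs : Differentiable ℝ (deriv (step d)) := h1.differentiable (by norm_num)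
  rw [deriv_cutoff]
  ext x
  exact ((hs x).hasDerivAt.sub ((hs _).hasDerivAt.comp_sub_const x (N * d))).deriv

end step

theorem norm_toLp_sq {f : ℝ → ℂ} (hf : MemLp f 2 volume) : ‖hf.toLp f‖ ^ 2 = ∫ x, ‖f x‖ ^ 2 := by
  have h0 : 0 ≤ ∫ x, ‖f x‖ ^ 2 := integral_nonneg fun x => by positivity
  rw [Lp.norm_toLp, hf.eLpNorm_eq_integral_rpow_norm (by norm_num) (by norm_num),
    ENNReal.toReal_ofReal (by positivity)]
  simp only [ENNReal.toReal_ofNat, Real.rpow_two]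
  rw [← Real.rpow_natCast, ← Real.rpow_mul h0]
  norm_num

section weyl

variable {d : ℝ} {Λ : SL2C} {E : ℝ} {v : Fin 2 → ℂ} {s : ℂ}

/-- The image of the cut off Bloch solution under `h_Λ - E` is bounded independently of the length
of the cutoff, since it only sees the two edges. -/
theorem exists_cutoff_bound (hd : 0 < d) {M : ℝ}
    (hM : ∀ x i, ‖(fundamental d Λ E x • v) i‖ ≤ M) :
    ∃ K : ℝ, ∀ (N : ℕ) (h2 : MemLp (fun x => (deriv (deriv (cutoff d N)) x : ℝ) *
      (fundamental d Λ E x • v) 0 + 2 * (deriv (cutoff d N) x : ℝ) *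
        (fundamental d Λ E x • v) 1) 2 volume), ‖h2.toLp _‖ ≤ K := by
  have hM0 : 0 ≤ M := (norm_nonneg _).trans (hM 0 0)
  set q : ℝ → ℝ := fun x => M * (|deriv (deriv (step d)) x| + 2 * |deriv (step d) x|) with hq
  have h1 : ContDiff ℝ 1 (deriv (step d)) :=
    ((contDiff_succ_iff_deriv (n := 1)).1 (by rw [one_add_one_eq_two]; exact contDiff_step d)).2.2
  have hc1 := h1.continuous
  have hc2 : Continuous (deriv (deriv (step d))) := h1.continuous_deriv le_rfl
  have hqc : Continuous q := by rw [hq]; fun_prop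
  have hqs : HasCompactSupport q := by
    have hs1 := hasCompactSupport_deriv_step hd
    have hs2 := hs1.deriv
    have a1 : HasCompactSupport fun x => |deriv (deriv (step d)) x| :=
      hs2.comp_left (g := fun y : ℝ => |y|) abs_zero
    have a2 : HasCompactSupport fun x => 2 * |deriv (step d) x| :=
      hs1.comp_left (g := fun y : ℝ => 2 * |y|) (by simp)
    exact (a1.add a2).comp_left (g := fun y : ℝ => M * y) (mul_zero M)
  have hqm : MemLp q 2 volume := hqc.memLp_of_hasCompactSupport hqs
  refine ⟨(eLpNorm q 2 volume + eLpNorm q 2 volume).toReal, fun N h2 => ?_⟩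
  rw [Lp.norm_toLp]
  refine ENNReal.toReal_mono (ENNReal.add_lt_top.2 ⟨hqm.2, hqm.2⟩).ne ?_
  have hmp : MeasurePreserving (fun x : ℝ => x - N * d) volume volume :=
    measurePreserving_sub_right volume (N * d : ℝ)
  have e : eLpNorm (fun x => q (x - N * d)) 2 volume = eLpNorm q 2 volume :=
    eLpNorm_comp_measurePreserving hqm.1 hmp
  calc _ ≤ eLpNorm (q + fun x => q (x - N * d)) 2 volume := by
        refine eLpNorm_mono_real fun x => ?_
        rw [deriv_deriv_cutoff, deriv_cutoff]
        beta_reduce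
        have b0 := hM x 0
        have b1 := hM x 1
        refine (norm_add_le _ _).trans ?_
        rw [norm_mul, norm_mul, norm_mul, Complex.norm_real, Complex.norm_real]
        simp only [Complex.norm_ofNat, Real.norm_eq_abs, Pi.add_apply, hq]
        have c2 := abs_sub (deriv (deriv (step d)) x) (deriv (deriv (step d)) (x - N * d))
        have c1 := abs_sub (deriv (step d) x) (deriv (step d) (x - N * d))
        calc _ ≤ (|deriv (deriv (step d)) x| + |deriv (deriv (step d)) (x - N * d)|) * M +
              2 * (|deriv (step d) x| + |deriv (step d) (x - N * d)|) * M := by gcongr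
          _ = _ := by ring
    _ ≤ _ := eLpNorm_add_le hqm.1 (hqm.1.comp_measurePreserving hmp) (by norm_num)
    _ = _ := by rw [e]

/-- If the monodromy matrix has an eigenvalue of modulus one, the energy is in the spectrum. -/
theorem not_isRegularPoint_of_eigenvector (hd : 0 < d) (hv : monodromy d Λ E • v = s • v)
    (hs : ‖s‖ = 1) (hv0 : v ≠ 0) : ¬ IsRegularPoint (kronigPenney d hd Λ.1) (E : ℂ) := by
  rintro ⟨R, -, hR⟩
  obtain ⟨M, hM0, hM⟩ := exists_fundamental_smul_bound hv hs hd
  obtain ⟨K, hK⟩ := exists_cutoff_bound hd hM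
  set u : ℝ → ℂ := fun x => (fundamental d Λ E x • v) 0 with hu
  have mu : AEStronglyMeasurable u volume :=
    (isCoeff_const v).aestronglyMeasurable hd locallyIntegrable_zero 0
  have hper : Function.Periodic (fun x => ‖u x‖ ^ 2) d := fun x => by
    have h : u (x + d) = s * u x := congrFun (fundamental_add_smul_eigenvector hd hv x) 0
    simp only [h, norm_mul, hs, one_mul]
  have hint : ∀ a b, IntervalIntegrable (fun x => ‖u x‖ ^ 2) volume a b := fun a b => by
    refine (intervalIntegrable_const (c := M ^ 2)).mono_fun (mu.norm.pow 2).restrict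
      (Eventually.of_forall fun x => ?_)
    have := hM x 0
    simp only [norm_pow, norm_norm]
    gcongr
    exact this.trans (le_abs_self M)
  -- the norms of the cut off solutions are bounded by the bounded inverse
  have hbound : ∀ n : ℕ, n • ∫ x in d..(d + d), ‖u x‖ ^ 2 ≤ (‖R‖ * K) ^ 2 := by
    intro n
    obtain ⟨h0, h2, hgr⟩ := inGraph_cutoff (Λ := Λ) (E := E) (v := v) hd (contDiff_cutoff d (n + 1))
      (hasCompactSupport_cutoff hd (n + 1)) (cutoff_eventually_const hd (n + 1)) hM
    rw [← mem_graph_kronigPenney hd, LinearPMap.mem_graph_iff] at hgr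
    obtain ⟨y, hy1, hy2⟩ := hgr
    simp only at hy1 hy2
    have hRy := hR y
    rw [hy2, hy1, sub_sub_cancel_left, map_neg] at hRy
    have h3 : ‖h0.toLp _‖ ≤ ‖R‖ * K := by
      rw [← hRy, norm_neg]
      exact (R.le_opNorm _).trans (by gcongr; exact hK _ h2)
    have h4 : ‖h0.toLp _‖ ^ 2 ≤ (‖R‖ * K) ^ 2 := by gcongr
    rw [norm_toLp_sq] at h4
    refine le_trans ?_ h4
    have h5 := hper.intervalIntegral_add_zsmul_eq n d hint
    rw [natCast_zsmul, natCast_zsmul] at h5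
    rw [← h5, intervalIntegral.integral_of_le (by
      rw [nsmul_eq_mul]; nlinarith [(Nat.cast_nonneg n : (0 : ℝ) ≤ n)])]
    have h6 : ∫ x in Set.Ioc d (d + n • d), ‖u x‖ ^ 2 =
        ∫ x in Set.Ioc d (d + n • d), ‖(cutoff d (n + 1) x : ℂ) * u x‖ ^ 2 := by
      refine setIntegral_congr_fun measurableSet_Ioc fun x hx => ?_
      rw [cutoff_eq_one hd (by linarith [hx.1]) (by
        rw [nsmul_eq_mul] at hx; push_cast; linarith [hx.2]), Complex.ofReal_one, one_mul]
    rw [h6]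
    exact setIntegral_le_integral ((memLp_two_iff_integrable_sq_norm h0.1).1 h0)
      (Eventually.of_forall fun x => by positivity)
  -- hence the Bloch solution vanishes
  have hzero : ∫ x in d..(d + d), ‖u x‖ ^ 2 = 0 := by
    have hnn : 0 ≤ ∫ x in d..(d + d), ‖u x‖ ^ 2 :=
      intervalIntegral.integral_nonneg (by linarith) fun x _ => by positivity
    by_contra hne
    have hpos := lt_of_le_of_ne hnn (Ne.symm hne)
    obtain ⟨n, hn⟩ := exists_nat_gt ((‖R‖ * K) ^ 2 / ∫ x in d..(d + d), ‖u x‖ ^ 2)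
    rw [div_lt_iff₀ hpos] at hn
    have := hbound n
    rw [nsmul_eq_mul] at this
    linarith
  have hae : ∀ᵐ x ∂volume.restrict (Set.Ioc d (d + d)), u x = 0 := by
    rw [intervalIntegral.integral_of_le (by linarith), setIntegral_eq_zero_iff_of_nonneg_ae
      (Eventually.of_forall fun x => by positivity)
      ((intervalIntegrable_iff_integrableOn_Ioc_of_le (by linarith)).1 (hint _ _))] at hzero
    filter_upwards [hzero] with x hx
    simpa using hx
  have hcell : ∀ x ∈ Set.Ioo d (d + d / 2), x ∈ freeRegion d := fun x hx =>
    cell_subset_freeRegion hd 1 ⟨by push_cast; linarith [hx.1], by push_cast; linarith [hx.2]⟩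
  have heq : Set.EqOn u (fun _ => 0) (Set.Ioo d (d + d / 2)) := by
    refine Measure.eqOn_open_of_ae_eq (μ := volume) ?_ isOpen_Ioo
      (fun x hx => (hasDerivAt_fundamental_smul_zero hd v
        (hcell x hx)).continuousAt.continuousWithinAt) continuousOn_const
    exact ae_restrict_of_ae_restrict_of_subset
      (show Set.Ioo d (d + d / 2) ⊆ Set.Ioc d (d + d) from
        fun x hx => ⟨hx.1, by linarith [hx.2]⟩) hae
  set x₀ : ℝ := d + d / 4
  have hx₀ : x₀ ∈ Set.Ioo d (d + d / 2) :=
    ⟨by simp only [x₀]; linarith, by simp only [x₀]; linarith⟩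
  have h1 : (fundamental d Λ E x₀ • v) 1 = 0 :=
    (hasDerivAt_fundamental_smul_zero hd v (hcell x₀ hx₀)).unique
      ((hasDerivAt_const x₀ (0 : ℂ)).congr_of_eventuallyEq
        (heq.eventuallyEq_of_mem (isOpen_Ioo.mem_nhds hx₀)))
  have h2 : fundamental d Λ E x₀ • v = 0 := by
    ext i
    fin_cases i
    · exact heq hx₀
    · exact h1
  exact hv0 ((smul_eq_zero_iff_eq _).1 h2)

end weyl

/-! ### The bottom of the spectrum -/

/-- The transfer matrix as a unimodular matrix. -/
noncomputable def transferSL {α β γ δ : ℝ} (hdet : α * β - γ * δ = -1) : SL2C :=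
  ⟨transferMatrix α β γ δ, by
    have h : (α : ℂ) * β - γ * δ = -1 := by exact_mod_cast hdet
    rw [transferMatrix, Matrix.det_fin_two_of]
    linear_combination -h⟩

/-- If the discriminant is `2 s` with a sign `s` at `E₀` and of modulus larger than `2` below, then
`E₀` is the bottom of the spectrum, and `s` is the multiplier of the Bloch solutions at `E₀`. -/
theorem bottom_of_discriminant {d : ℝ} (hd : 0 < d) {α β γ δ : ℝ} (hdet : α * β - γ * δ = -1)
    {E₀ s : ℝ} (hs : s = 1 ∨ s = -1) (hE₀ : discriminant d α β γ δ E₀ = 2 * s)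
    (hlt : ∀ E < E₀, 2 < |discriminant d α β γ δ E|) :
    IsLeast (realSpectrum d hd (transferMatrix α β γ δ)) E₀ ∧
      (∃ (θ : ℝ) (u : ℝ → ℂ), IsBlochSolution d (transferMatrix α β γ δ) E₀ θ u) ∧
      ∀ (θ : ℝ) (u : ℝ → ℂ), IsBlochSolution d (transferMatrix α β γ δ) E₀ θ u →
        ∀ x ∈ freeRegion d, u (x + d) = s * u x := by
  set Λ : SL2C := transferSL hdet
  have hΛ : Λ.1 = transferMatrix α β γ δ := rfl
  have htr : ∀ E, (monodromy d Λ E).1.trace = discriminant d α β γ δ E :=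
    trace_monodromy hΛ
  have hs2 : (s : ℂ) ^ 2 = 1 := by rcases hs with rfl | rfl <;> simp
  have hsn : ‖(s : ℂ)‖ = 1 := by rcases hs with rfl | rfl <;> simp
  have htr0 : (monodromy d Λ E₀).1.trace = 2 * (s : ℂ) := by
    rw [htr, hE₀]; push_cast; ring
  obtain ⟨v, hv0, hv⟩ := exists_eigenvector hs2 htr0
  refine ⟨⟨?_, fun E hE => ?_⟩, ?_, fun θ u hu x hx => ?_⟩
  · rw [← hΛ]
    exact not_isRegularPoint_of_eigenvector hd hv hsn hv0
  · by_contra hcon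
    refine hE ?_
    rw [← hΛ]
    refine isRegularPoint_of_two_lt hd Λ E ?_
    rw [htr, Complex.norm_real]
    exact hlt E (not_le.1 hcon)
  · obtain ⟨θ, hθ⟩ : ∃ θ : ℝ, Complex.exp (θ * Complex.I) = s := by
      rcases hs with rfl | rfl
      · exact ⟨0, by simp⟩
      · exact ⟨Real.pi, by simp [Complex.exp_pi_mul_I]⟩
    exact ⟨θ, _, exists_isBlochSolution hd hv hv0 hθ⟩
  · -- the multiplier `m` solves `m + m⁻¹ = 2 s`, hence equals `s`
    obtain ⟨y, hy, hyne⟩ := hu.nonzero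
    have h1 := add_sub_eq_discriminant_mul (Λ := Λ) hd hu.differentiableAt hu.equation hu.matching hy
    have h2 := hu.quasiperiodic y hy
    have h3 := hu.quasiperiodic (y - d) ((sub_mem_freeRegion_iff hd).2 hy)
    rw [sub_add_cancel] at h3
    set m := Complex.exp (θ * Complex.I)
    rw [htr0] at h1
    have h4 : (m - s) ^ 2 * u y = 0 := by
      linear_combination m * h1 - m * h2 + h3 + u y * hs2
    have h5 : m = s := by
      rcases mul_eq_zero.1 h4 with h | h
      · exact sub_eq_zero.1 (pow_eq_zero_iff (two_ne_zero) |>.1 h)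
      · exact absurd h hyne
    rw [hu.quasiperiodic x hx, ← h5]

end KronigPenney

theorem mainTheorem6 (d : ℝ) (hd : 0 < d) (α β γ δ : ℝ) (hdet : α * β - γ * δ = -1) :
    let Λ := KronigPenney.transferMatrix α β γ δ
    let σ := KronigPenney.realSpectrum d hd Λ
    let E₀ := sInf σ
    σ.Nonempty ∧ BddBelow σ ∧
    (∃ (θ : ℝ) (u : ℝ → ℂ), KronigPenney.IsBlochSolution d Λ E₀ θ u) ∧
    ∀ (θ : ℝ) (u : ℝ → ℂ), KronigPenney.IsBlochSolution d Λ E₀ θ u →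
      ((0 < β ∨ (β = 0 ∧ 0 < γ)) → ∀ x ∈ KronigPenney.freeRegion d, u (x + d) = u x) ∧
      ((β < 0 ∨ (β = 0 ∧ γ < 0)) → ∀ x ∈ KronigPenney.freeRegion d, u (x + d) = -u x) := by
  intro Λ σ E₀
  by_cases h : 0 < β ∨ (β = 0 ∧ 0 < γ)
  · obtain ⟨E₁, h1, h2⟩ := KronigPenney.exists_discriminant_eq_two hd hdet h
    obtain ⟨hl, hb, hall⟩ := KronigPenney.bottom_of_discriminant hd hdet (s := 1) (Or.inl rfl)
      (by rw [h1]; ring) fun E hE => (h2 E hE).trans_le (le_abs_self _)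
    have hE : E₀ = E₁ := hl.csInf_eq
    rw [hE]
    refine ⟨⟨E₁, hl.1⟩, ⟨E₁, hl.2⟩, hb, fun θ u hu => ⟨fun _ x hx => ?_, fun h' => ?_⟩⟩
    · simpa using hall θ u hu x hx
    · exfalso
      rcases h with h | ⟨h, h3⟩ <;> rcases h' with h' | ⟨h', h4⟩ <;> linarith
  · -- here `-Λ` satisfies the conditions of the first case
    have hneg : 0 < -β ∨ (-β = 0 ∧ 0 < -γ) := by
      rcases lt_trichotomy β 0 with hβ | hβ | hβ
      · left; linarith
      · right
        refine ⟨by linarith, ?_⟩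
        have hγ : γ ≤ 0 := not_lt.1 fun hγ => h (Or.inr ⟨hβ, hγ⟩)
        rcases hγ.lt_or_eq with hγ | hγ
        · linarith
        · rw [hβ, hγ] at hdet; norm_num at hdet
      · exact absurd (Or.inl hβ) h
    have hdet' : -α * -β - -γ * -δ = -1 := by linarith
    obtain ⟨E₁, h1, h2⟩ := KronigPenney.exists_discriminant_eq_two hd hdet' hneg
    simp only [KronigPenney.discriminant_neg] at h1 h2
    obtain ⟨hl, hb, hall⟩ := KronigPenney.bottom_of_discriminant hd hdet (s := -1) (Or.inr rfl)
      (by linarith) fun E hE => (h2 E hE).trans_le (neg_le_abs _)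
    have hE : E₀ = E₁ := hl.csInf_eq
    rw [hE]
    refine ⟨⟨E₁, hl.1⟩, ⟨E₁, hl.2⟩, hb, fun θ u hu => ⟨fun h' => absurd h' h, fun _ x hx => ?_⟩⟩
    simpa using hall θ u hu x hx
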